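/- For $q\in(0,1)$ and complex $a,b,c$ let $(a;q)_n=\prod_{k=0}^{n-1}(1-aq^k)$ and let $$\Phi[a,b;c;q,w]=\sum_{n=0}^\infty \frac{(a;q)_n(b;q)_n}{(c;q)_n(q;q)_n}\,w^n\qquad(|w|<1)$$ be Heine's basic hypergeometric function, where $(c;q)_n\neq 0$ for all $n$. **Theorem.** Let $q\in(0,1)$ and let $a,b,c\ge 0$ be real numbers with $0\le q(b-c)\le 1-cq$ and $0<a-c\le 1-c$. Then there are a non-decreasing function $\mu:[0,1]\to[0,1]$ with $\mu(1)-\mu(0)=1$ and a function $f$ analytic in the cut plane $\mathbb{C}\setminus[1,\infty)$ such that: 1. for every $z\in\mathbb{C}\setminus[1,\infty)$ with $|qz|<1$ (in particular for $|z|<1$), $\Phi[a,b;c;q,qz]\neq 0$ and $$f(z)=\frac{z\,\Phi[a,bq;cq;q,qz]}{\Phi[a,b;c;q,qz]},$$ so that $f$ is the unique analytic continuation of this ratio to the cut plane; 2. for every $z\in\mathbb{C}\setminus[1,\infty)$, $f(z)=\displaystyle\int_0^1\frac{z}{1-tz}\,d\mu(t)$ (Stieltjes integral over $[0,1]$); 3.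 $f$ maps both the unit disk $\{|z|<1\}$ and the half-plane $\{\operatorname{Re}z<1\}$ univalently (one-to-one) onto domains that are convex in the direction of the imaginary axis, i.e. open connected sets whose intersection with any line parallel to the imaginary axis is empty or a (possibly unbounded) line segment. -/

import Mathlib

open Set MeasureTheory

/-- Watson's symbol `(a;q)_n = (1 - a)(1 - aq) ⋯ (1 - aq^(n-1))`, with `(a;q)_0 = 1`. -/
def watsonSymbol (a q : ℂ) (n : ℕ) : ℂ := ∏ k ∈ Finset.range n, (1 - a * q ^ k)

/-- The basic (Heine) hypergeometric function
`Φ[a,b;c;q,z] = ∑ (a;q)_n (b;q)_n / ((c;q)_n (q;q)_n) z^n`. It is used only for `|z| < 1`,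
`0 < q < 1` and `0 ≤ c < 1`, where the denominators do not vanish and the series converges
absolutely. -/
noncomputable def heinePhi (a b c q z : ℂ) : ℂ :=
  ∑' n : ℕ, watsonSymbol a q n * watsonSymbol b q n /
    (watsonSymbol c q n * watsonSymbol q q n) * z ^ n

/-- The Lebesgue–Stieltjes measure on `ℝ` of a non-decreasing function `μ : [0,1] → [0,1]`, where
`μ` is continued by `μ(0)` to the left of `0` and by `μ(1)` to the right of `1`. It is carried by
`[0,1]`, has total mass `μ(1) - μ(0)`, and charges the points `0` and `1` with the jumps
`μ(0+) - μ(0)` and `μ(1) - μ(1-)`. -/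
noncomputable def stieltjesMeasure (μ : unitInterval →o unitInterval) : Measure ℝ :=
  (Monotone.stieltjesFunction (f := IccExtend (zero_le_one' ℝ) fun t => (μ t : ℝ))
    (Monotone.IccExtend (zero_le_one' ℝ) fun _ _ h => μ.monotone h)).measure

/-- The Stieltjes integral `∫₀¹ h(t) dμ(t)` over the closed interval `[0,1]`. -/
noncomputable def stieltjesIntegral (μ : unitInterval →o unitInterval) (h : ℝ → ℂ) : ℂ :=
  ∫ t in Icc (0 : ℝ) 1, h t ∂(stieltjesMeasure μ)

/-- The cut plane `ℂ ∖ [1,∞)`. -/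
def cutPlane : Set ℂ := {z | ¬ (1 ≤ z.re ∧ z.im = 0)}

/-- A domain: a non-empty open connected subset of `ℂ`. -/
def IsPlaneDomain (D : Set ℂ) : Prop := IsOpen D ∧ IsConnected D

/-- `D` is convex in the direction of the imaginary axis: every line parallel to the imaginary axis
meets `D` in the empty set or in a (possibly unbounded) segment, that is, in a convex set. -/
def ConvexInImDirection (D : Set ℂ) : Prop := ∀ x : ℝ, Convex ℝ (D ∩ {w : ℂ | w.re = x})

/-- `f` maps `U` univalently (one-to-one) onto a domain that is convex in the direction of the
imaginary axis; analyticity of `f` is stated separately. -/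
def MapsUnivalentlyOntoConvexInIm (f : ℂ → ℂ) (U : Set ℂ) : Prop :=
  InjOn f U ∧ IsPlaneDomain (f '' U) ∧ ConvexInImDirection (f '' U)

open Filter Topology
open scoped InnerProductSpace CompactlySupported ComplexConjugate

/-! ### The symbol `(a;q)_n` -/

/-! Heine's contiguous relation links the functions `φ n` of `heineChain` by `φ (n+1) - φ n = (1 - g
n) g (n+1) z φ (n+2)` (`heineChain_recurrence`). The hypotheses on `a, b, c` amount to `0 ≤ g n ≤
1`, so `φ 1 / φ 0` is formally a g-fraction. Its integral representation comes from spectral theory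
instead of convergence of continued fractions. The Jacobi matrix `J` with zero diagonal and
off-diagonal entries `√((1 - g n) g (n+1))` is a self-adjoint contraction on ℓ². For `w² = z`, the
numbers `φ (n+1)`, rescaled by powers of `w` and products of entries, form an ℓ² vector `x` with `(1
- wJ)x = φ 0 • e₀`. Pairing with `e₀` gives `φ 1 = φ 0 ∫ 1/(1 - wl) dν(l)` for the spectral measure
`ν` at `e₀`. Averaging over `±w` and pushing forward under `l ↦ l²` gives a probability measure on
`[0,1]` (`exists_measure_of_gFraction`).

The same identity shows that a zero of `φ 0` is a zero of `φ 1`. Outside degenerate cases the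
recurrence carries it to every `φ n`, contradicting the nonzero limit `Φ[0,0;0]`
(`heineChain_zero_ne_zero`).

The geometry holds for every such transform. In the coordinate `σ`, with `z = (e^σ - 1)/(e^σ + κ)`
and `|Im σ| < π/2`, a difference of values is `2 sinh((σ - τ)/2)` times a number of positive real
part (`exists_cauchyTransform_sub`). This gives injectivity and a real part increasing along
horizontal lines. Since the real part also has the same range on every such line
(`re_cauchyTransform_range`), each nonempty level set of it is a graph over `Im σ`, and its image is
a vertical segment (`convexInImDirection_image_strip`). -/

theorem watsonSymbol_zero (a q : ℂ) : watsonSymbol a q 0 = 1 := by simp [watsonSymbol]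

theorem watsonSymbol_succ (a q : ℂ) (n : ℕ) :
    watsonSymbol a q (n + 1) = watsonSymbol a q n * (1 - a * q ^ n) := by
  simp [watsonSymbol, Finset.prod_range_succ]

theorem watsonSymbol_succ' (a q : ℂ) (n : ℕ) :
    watsonSymbol a q (n + 1) = (1 - a) * watsonSymbol (a * q) q n := by
  simp only [watsonSymbol, Finset.prod_range_succ', pow_zero, mul_one]
  rw [mul_comm]
  congr 1
  exact Finset.prod_congr rfl fun k _ => by ring

theorem watsonSymbol_zero_left (q : ℂ) (n : ℕ) : watsonSymbol 0 q n = 1 := by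
  simp [watsonSymbol]

theorem watsonSymbol_one_left (q : ℂ) (n : ℕ) : watsonSymbol 1 q (n + 1) = 0 := by
  rw [watsonSymbol_succ', sub_self, zero_mul]

theorem continuous_watsonSymbol (q : ℂ) (n : ℕ) : Continuous fun a => watsonSymbol a q n := by
  unfold watsonSymbol
  fun_prop

theorem norm_watsonSymbol_ofReal (a q : ℝ) (n : ℕ) :
    ‖watsonSymbol a q n‖ = ∏ k ∈ Finset.range n, |1 - a * q ^ k| := by
  rw [watsonSymbol, norm_prod]
  refine Finset.prod_congr rfl fun k _ => ?_
  rw [← Real.norm_eq_abs, ← Complex.norm_real]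
  push_cast
  rfl

theorem norm_watsonSymbol_le_one {a q : ℝ} (hq0 : 0 ≤ q) (hq1 : q ≤ 1) (ha0 : 0 ≤ a)
    (ha1 : a ≤ 1) (n : ℕ) : ‖watsonSymbol a q n‖ ≤ 1 := by
  rw [norm_watsonSymbol_ofReal]
  refine Finset.prod_le_one (fun _ _ => abs_nonneg _) fun k _ => ?_
  have h1 : a * q ^ k ≤ 1 := mul_le_one₀ ha1 (by positivity) (pow_le_one₀ hq0 hq1)
  have h0 : 0 ≤ a * q ^ k := by positivity
  rw [abs_le]
  constructor <;> linarith

/-- Here `b` may exceed 1, but only the first factor feels this: the others form the symbol of `b *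
q ≤ 1`. -/
theorem norm_watsonSymbol_le {b q : ℝ} (hq0 : 0 < q) (hq1 : q ≤ 1) (hb0 : 0 ≤ b)
    (hb1 : b * q ≤ 1) (n : ℕ) : ‖watsonSymbol b q n‖ ≤ 1 / q := by
  have hq : 1 ≤ 1 / q := by rw [le_div_iff₀ hq0]; linarith
  cases n with
  | zero => simpa [watsonSymbol_zero] using hq
  | succ n =>
    have hb : b ≤ 1 / q := by rwa [le_div_iff₀ hq0]
    have h1 : ‖(1 - b : ℂ)‖ ≤ 1 / q := by
      rw [show (1 - b : ℂ) = ((1 - b : ℝ) : ℂ) by push_cast; rfl, Complex.norm_real,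
        Real.norm_eq_abs, abs_le]
      constructor <;> linarith
    have h2 := norm_watsonSymbol_le_one hq0.le hq1 (by positivity) hb1 n
    rw [watsonSymbol_succ', norm_mul]
    push_cast at h2
    calc _ ≤ 1 / q * 1 := mul_le_mul h1 h2 (norm_nonneg _) (by positivity)
      _ = _ := mul_one _

/-- Weierstrass' product inequality. -/
theorem one_sub_sum_le_prod_one_sub {ι : Type*} (s : Finset ι) (x : ι → ℝ) (h0 : ∀ i, 0 ≤ x i)
    (h1 : ∀ i, x i ≤ 1) : 1 - ∑ i ∈ s, x i ≤ ∏ i ∈ s, (1 - x i) := by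
  classical
  induction s using Finset.induction_on with
  | empty => simp
  | insert i s hi ih =>
    rw [Finset.sum_insert hi, Finset.prod_insert hi]
    have hp : ∏ i ∈ s, (1 - x i) ≤ 1 :=
      Finset.prod_le_one (fun i _ => by linarith [h1 i]) fun i _ => by linarith [h0 i]
    nlinarith [h0 i]

/-- Cut the product where the tail of `∑ c q^k` drops below 1/2: the later factors multiply to at
least 1/2, the finitely many earlier ones are positive. Uniformity in `c'` holds as each factor
decreases in it, and is needed because the chain uses all `c q^n`. -/
theorem exists_pos_le_norm_watsonSymbol {c q : ℝ} (hq0 : 0 < q) (hq1 : q < 1) (hc0 : 0 ≤ c)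
    (hc1 : c < 1) :
    ∃ δ > 0, ∀ c', 0 ≤ c' → c' ≤ c → ∀ n, δ ≤ ‖watsonSymbol (c' : ℝ) q n‖ := by
  have hs : Summable fun k : ℕ => c * q ^ k := (summable_geometric_of_lt_one hq0.le hq1).mul_left c
  obtain ⟨K, hK⟩ : ∃ K, ∑' k, c * q ^ (k + K) < 1 / 2 :=
    ((tendsto_sum_nat_add fun k : ℕ => c * q ^ k).eventually_lt_const (by norm_num)).exists
  have hle : ∀ k, c * q ^ k ≤ c := fun k =>
    mul_le_of_le_one_right hc0 (pow_le_one₀ hq0.le hq1.le)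
  have hpos : ∀ k, 0 < 1 - c * q ^ k := fun k => by linarith [hle k]
  have key : ∀ n, (∏ k ∈ Finset.range K, (1 - c * q ^ k)) * (1 / 2) ≤
      ∏ k ∈ Finset.range (K + n), (1 - c * q ^ k) := by
    intro n
    rw [Finset.prod_range_add]
    refine mul_le_mul_of_nonneg_left ?_ (Finset.prod_nonneg fun k _ => (hpos k).le)
    refine le_trans ?_ (one_sub_sum_le_prod_one_sub _ _ (fun i => by positivity)
      fun i => (hle _).trans hc1.le)
    have := ((summable_nat_add_iff K).2 hs).sum_le_tsum (Finset.range n)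
      (fun i _ => by positivity)
    simp only [add_comm K]
    linarith
  have anti : ∀ n, ∏ k ∈ Finset.range (K + n), (1 - c * q ^ k) ≤
      ∏ k ∈ Finset.range n, (1 - c * q ^ k) := by
    intro n
    rw [add_comm, Finset.prod_range_add]
    refine mul_le_of_le_one_right (Finset.prod_nonneg fun k _ => (hpos k).le) ?_
    refine Finset.prod_le_one (fun k _ => (hpos _).le) fun k _ => ?_
    have : 0 ≤ c * q ^ (n + k) := by positivity
    linarith
  refine ⟨(∏ k ∈ Finset.range K, (1 - c * q ^ k)) * (1 / 2),
    mul_pos (Finset.prod_pos fun k _ => hpos k) (by norm_num), fun c' h0 h1 n => ?_⟩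
  rw [norm_watsonSymbol_ofReal]
  refine ((key n).trans (anti n)).trans (Finset.prod_le_prod (fun k _ => (hpos k).le) fun k _ => ?_)
  have := mul_le_mul_of_nonneg_right h1 (pow_nonneg hq0.le k)
  exact le_trans (by linarith) (le_abs_self _)

theorem watsonSymbol_ne_zero {c q : ℝ} (hq0 : 0 < q) (hq1 : q < 1) (hc0 : 0 ≤ c) (hc1 : c < 1)
    (n : ℕ) : watsonSymbol c q n ≠ 0 := by
  obtain ⟨δ, hδ, h⟩ := exists_pos_le_norm_watsonSymbol hq0 hq1 hc0 hc1
  exact norm_pos_iff.1 (hδ.trans_le (h c hc0 le_rfl n))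

theorem one_sub_mul_pow_ne_zero {c q : ℝ} (hq0 : 0 < q) (hq1 : q < 1) (hc1 : c < 1)
    (n : ℕ) (hc0 : 0 ≤ c) : (1 - c * q ^ n : ℂ) ≠ 0 := by
  have : c * q ^ n < 1 := lt_of_le_of_lt
    (mul_le_of_le_one_right hc0 (pow_le_one₀ hq0.le hq1.le)) hc1
  exact_mod_cast (sub_pos.2 this).ne'

/-! ### Heine's series -/

/-- The `n`-th coefficient of Heine's series. -/
noncomputable def heineCoeff (a b c q : ℂ) (n : ℕ) : ℂ :=
  watsonSymbol a q n * watsonSymbol b q n / (watsonSymbol c q n * watsonSymbol q q n)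

theorem heinePhi_eq_tsum (a b c q z : ℂ) :
    heinePhi a b c q z = ∑' n : ℕ, heineCoeff a b c q n * z ^ n := rfl

theorem heineCoeff_zero (a b c q : ℂ) : heineCoeff a b c q 0 = 1 := by
  simp [heineCoeff, watsonSymbol_zero]

theorem heineCoeff_comm (a b c q : ℂ) (n : ℕ) : heineCoeff a b c q n = heineCoeff b a c q n := by
  rw [heineCoeff, heineCoeff, mul_comm (watsonSymbol a q n)]

theorem heinePhi_comm (a b c q z : ℂ) : heinePhi a b c q z = heinePhi b a c q z := by
  simp_rw [heinePhi_eq_tsum, heineCoeff_comm a b]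

theorem heinePhi_one_left (b c q z : ℂ) : heinePhi 1 b c q z = 1 := by
  rw [heinePhi_eq_tsum, tsum_eq_single 0]
  · simp [heineCoeff_zero]
  · intro n hn
    obtain ⟨m, rfl⟩ := Nat.exists_eq_succ_of_ne_zero hn
    simp [heineCoeff, watsonSymbol_one_left]

/-- The coefficients of Heine's series are bounded, uniformly in the parameters. -/
theorem exists_norm_heineCoeff_le {c q : ℝ} (hq0 : 0 < q) (hq1 : q < 1) (hc0 : 0 ≤ c)
    (hc1 : c < 1) :
    ∃ M > 0, ∀ a b c' : ℝ, 0 ≤ a → a * q ≤ 1 → 0 ≤ b → b * q ≤ 1 → 0 ≤ c' → c' ≤ c →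
      ∀ n, ‖heineCoeff a b c' q n‖ ≤ M := by
  obtain ⟨δ, hδ, h⟩ := exists_pos_le_norm_watsonSymbol hq0 hq1 hc0 hc1
  obtain ⟨ε, hε, h'⟩ := exists_pos_le_norm_watsonSymbol hq0 hq1 hq0.le hq1
  refine ⟨1 / q * (1 / q) / (δ * ε), by positivity, fun a b c' ha0 ha1 hb0 hb1 h0 h1 n => ?_⟩
  rw [heineCoeff, norm_div, norm_mul, norm_mul]
  exact div_le_div₀ (by positivity)
    (mul_le_mul (norm_watsonSymbol_le hq0 hq1.le ha0 ha1 n)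
      (norm_watsonSymbol_le hq0 hq1.le hb0 hb1 n) (norm_nonneg _) (by positivity)) (by positivity)
    (mul_le_mul (h c' h0 h1 n) (h' q hq0.le le_rfl n) hε.le (norm_nonneg _))

theorem summable_bounded_mul_pow {u : ℕ → ℂ} {M : ℝ} (hu : ∀ n, ‖u n‖ ≤ M) {z : ℂ}
    (hz : ‖z‖ < 1) : Summable fun n => u n * z ^ n := by
  refine Summable.of_norm_bounded
    ((summable_geometric_of_lt_one (norm_nonneg z) hz).mul_left M) fun n => ?_
  rw [norm_mul, norm_pow]
  exact mul_le_mul_of_nonneg_right (hu n) (by positivity)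

theorem summable_heine {a b c q : ℝ} (hq0 : 0 < q) (hq1 : q < 1) (ha0 : 0 ≤ a) (ha1 : a * q ≤ 1)
    (hb0 : 0 ≤ b) (hb1 : b * q ≤ 1) (hc0 : 0 ≤ c) (hc1 : c < 1) {z : ℂ} (hz : ‖z‖ < 1) :
    Summable fun n => heineCoeff a b c q n * z ^ n := by
  obtain ⟨M, -, h⟩ := exists_norm_heineCoeff_le hq0 hq1 hc0 hc1
  exact summable_bounded_mul_pow (h a b c ha0 ha1 hb0 hb1 hc0 le_rfl) hz

/-- The coefficient form of Heine's contiguous relation. -/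
theorem heineCoeff_contiguous {a b c q : ℝ} (hq0 : 0 < q) (hq1 : q < 1) (hc0 : 0 ≤ c)
    (hc1 : c < 1) (n : ℕ) :
    heineCoeff a (b * q) (c * q) q (n + 1) - heineCoeff a b c q (n + 1) =
      ((1 - a) * (b - c) / ((1 - c) * (1 - c * q))) *
        heineCoeff (a * q) (b * q) (c * q * q) q n := by
  have hcq1 : c * q < 1 := by nlinarith
  have hc2 : c * q * q < 1 := by nlinarith [mul_nonneg hc0 hq0.le]
  have n1 : (1 - c : ℂ) ≠ 0 := by exact_mod_cast (sub_pos.2 hc1).ne'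
  have n2 : (1 - c * q : ℂ) ≠ 0 := by exact_mod_cast (sub_pos.2 hcq1).ne'
  have n3 : (1 - c * q * q ^ n : ℂ) ≠ 0 := by
    have := one_sub_mul_pow_ne_zero hq0 hq1 hcq1 n (by positivity)
    push_cast at this; exact this
  have n4 : watsonSymbol (c * q * q : ℂ) q n ≠ 0 := by
    have := watsonSymbol_ne_zero hq0 hq1 (by positivity) hc2 n
    push_cast at this; exact this
  have n5 : watsonSymbol (q : ℂ) q n ≠ 0 := watsonSymbol_ne_zero hq0 hq1 hq0.le hq1 n
  have n6 : (1 - q * q ^ n : ℂ) ≠ 0 := one_sub_mul_pow_ne_zero hq0 hq1 hq1 n hq0.le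
  have e1 : watsonSymbol (c * q : ℂ) q n * (1 - c * q * q ^ n) =
      (1 - c * q) * watsonSymbol (c * q * q) q n := by
    rw [← watsonSymbol_succ, watsonSymbol_succ']
  have e2 : watsonSymbol (c * q : ℂ) q n =
      (1 - c * q) * watsonSymbol (c * q * q) q n / (1 - c * q * q ^ n) := by
    rw [← e1, mul_div_cancel_right₀ _ n3]
  simp only [heineCoeff]
  rw [watsonSymbol_succ (b * q : ℂ), watsonSymbol_succ (c * q : ℂ), watsonSymbol_succ (q : ℂ),
    watsonSymbol_succ' (a : ℂ), watsonSymbol_succ' (b : ℂ), watsonSymbol_succ' (c : ℂ), e2]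
  clear e1 e2
  -- All symbols now have the shifted bases `aq, bq, cq², q`, so only a rational identity in `q^n`
  -- remains.
  generalize watsonSymbol (c * q * q : ℂ) q n = C at *
  generalize (q : ℂ) ^ n = t at *
  generalize watsonSymbol (q : ℂ) q n = Q at *
  generalize watsonSymbol (a * q : ℂ) q n = A at *
  generalize watsonSymbol (b * q : ℂ) q n = B at *
  generalize hu : (c * q * t : ℂ) = u at *
  generalize hv : (q * t : ℂ) = v at *
  generalize hp : (c * q : ℂ) = p at *
  have hw : (b * q * t : ℂ) = b * v := by rw [← hv]; ring
  have hu' : u = c * v := by rw [← hu, ← hv, ← hp]; ring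
  rw [hw]
  field_simp
  rw [hu']
  ring

/-- Heine's contiguous relation. -/
theorem heinePhi_contiguous {a b c q : ℝ} (hq0 : 0 < q) (hq1 : q < 1) (ha0 : 0 ≤ a)
    (ha1 : a * q ≤ 1) (hb0 : 0 ≤ b) (hb1 : b * q ≤ 1) (hc0 : 0 ≤ c) (hc1 : c < 1) {z : ℂ}
    (hz : ‖z‖ < 1) :
    heinePhi a (b * q) (c * q) q z - heinePhi a b c q z =
      ((1 - a) * (b - c) / ((1 - c) * (1 - c * q))) * z *
        heinePhi (a * q) (b * q) (c * q * q) q z := by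
  have hcq1 : c * q < 1 := by nlinarith
  have hbq : b * q * q ≤ 1 := by nlinarith [mul_nonneg hb0 hq0.le]
  have s1 := summable_heine hq0 hq1 ha0 ha1 hb0 hb1 hc0 hc1 hz
  have s2 := summable_heine hq0 hq1 ha0 ha1 (by positivity) hbq (by positivity) hcq1 hz
  push_cast at s2
  simp only [heinePhi_eq_tsum]
  rw [s1.tsum_eq_zero_add, s2.tsum_eq_zero_add, heineCoeff_zero, heineCoeff_zero,
    add_sub_add_left_eq_sub, ← Summable.tsum_sub ((summable_nat_add_iff 1).2 s2)
      ((summable_nat_add_iff 1).2 s1), ← tsum_mul_left]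
  refine tsum_congr fun n => ?_
  rw [← sub_mul, heineCoeff_contiguous hq0 hq1 hc0 hc1]
  ring

/-! ### The `q`-binomial series -/

theorem qBinomial_coeff_succ {a q : ℝ} (hq0 : 0 < q) (hq1 : q < 1) (n : ℕ) :
    heineCoeff a 0 0 q (n + 1) * (1 - q ^ (n + 1)) = heineCoeff a 0 0 q n * (1 - a * q ^ n) := by
  have n5 : watsonSymbol (q : ℂ) q n ≠ 0 := watsonSymbol_ne_zero hq0 hq1 hq0.le hq1 n
  have n6 : (1 - q * q ^ n : ℂ) ≠ 0 := one_sub_mul_pow_ne_zero hq0 hq1 hq1 n hq0.le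
  simp only [heineCoeff, watsonSymbol_zero_left]
  rw [watsonSymbol_succ, watsonSymbol_succ, pow_succ']
  generalize (q : ℂ) ^ n = t at *
  generalize (q * t : ℂ) = v at *
  field_simp

/-- The two-term recurrence of the coefficients, summed against powers of `z`. -/
theorem qBinomial_functional_equation {a q : ℝ} (hq0 : 0 < q) (hq1 : q < 1) (ha0 : 0 ≤ a)
    (ha1 : a * q ≤ 1) {z : ℂ} (hz : ‖z‖ < 1) :
    (1 - z) * heinePhi a 0 0 q z = (1 - a * z) * heinePhi a 0 0 q (q * z) := by
  have hqz : ‖(q : ℂ) * z‖ < 1 := by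
    rw [norm_mul, Complex.norm_real, Real.norm_of_nonneg hq0.le]
    nlinarith [norm_nonneg z]
  have s1 := summable_heine hq0 hq1 ha0 ha1 le_rfl (by simp) le_rfl one_pos hz
  have s2 := summable_heine hq0 hq1 ha0 ha1 le_rfl (by simp) le_rfl one_pos hqz
  simp only [Complex.ofReal_zero] at s1 s2
  have key : heinePhi a 0 0 q z - heinePhi a 0 0 q (q * z) =
      z * (heinePhi a 0 0 q z - a * heinePhi a 0 0 q (q * z)) := by
    simp only [heinePhi_eq_tsum]
    rw [← tsum_mul_left, ← s1.tsum_sub (s2.mul_left _), ← tsum_mul_left, ← s1.tsum_sub s2,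
      (s1.sub s2).tsum_eq_zero_add]
    simp only [pow_zero, sub_self, zero_add]
    refine tsum_congr fun n => ?_
    have := qBinomial_coeff_succ (a := a) hq0 hq1 n
    rw [mul_pow, mul_pow]
    linear_combination z ^ (n + 1) * this
  linear_combination key

theorem heinePhi_zero (a b c q : ℂ) : heinePhi a b c q 0 = 1 := by
  rw [heinePhi_eq_tsum, tsum_eq_single 0]
  · simp [heineCoeff_zero]
  · intro n hn
    simp [hn]

/-- Tannery's theorem with a geometric majorant. -/
theorem tendsto_tsum_mul_pow_of_bounded {u : ℕ → ℕ → ℂ} {v : ℕ → ℂ} {y : ℕ → ℂ} {x : ℂ} {M r : ℝ}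
    (hu : ∀ m n, ‖u m n‖ ≤ M) (hy : ∀ m, ‖y m‖ ≤ r) (hr : r < 1)
    (hlim : ∀ n, Tendsto (fun m => u m n) atTop (𝓝 (v n))) (hylim : Tendsto y atTop (𝓝 x)) :
    Tendsto (fun m => ∑' n, u m n * y m ^ n) atTop (𝓝 (∑' n, v n * x ^ n)) := by
  have hr0 : 0 ≤ r := (norm_nonneg _).trans (hy 0)
  refine tendsto_tsum_of_dominated_convergence
    ((summable_geometric_of_lt_one hr0 hr).mul_left M) (fun n => (hlim n).mul (hylim.pow n))
    (Eventually.of_forall fun m n => ?_)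
  rw [norm_mul, norm_pow]
  exact mul_le_mul (hu m n) (pow_le_pow_left₀ (norm_nonneg _) (hy m) n) (by positivity)
    ((norm_nonneg _).trans (hu m n))

/-- By the functional equation a zero at `z` propagates to all `q^n z`, as `1 - a q^n z` does not
vanish; these points tend to 0, where the value is 1. -/
theorem qBinomial_ne_zero {a q : ℝ} (hq0 : 0 < q) (hq1 : q < 1) (ha0 : 0 ≤ a) (ha1 : a ≤ 1)
    {z : ℂ} (hz : ‖z‖ < 1) : heinePhi a 0 0 q z ≠ 0 := by
  intro h0
  have haq : a * q ≤ 1 := by nlinarith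
  have hn : ∀ n : ℕ, ‖(q : ℂ) ^ n * z‖ ≤ ‖z‖ := fun n => by
    rw [norm_mul, norm_pow, Complex.norm_real, Real.norm_of_nonneg hq0.le]
    exact mul_le_of_le_one_left (norm_nonneg z) (pow_le_one₀ hq0.le hq1.le)
  have hall : ∀ n : ℕ, heinePhi a 0 0 q ((q : ℂ) ^ n * z) = 0 := by
    intro n
    induction n with
    | zero => simpa using h0
    | succ n ih =>
      have hlt := (hn n).trans_lt hz
      have h := qBinomial_functional_equation hq0 hq1 ha0 haq hlt
      rw [ih, mul_zero, ← mul_assoc (q : ℂ), ← pow_succ'] at h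
      refine (mul_eq_zero.1 h.symm).resolve_left fun h1 => ?_
      have h2 : ‖(a : ℂ) * ((q : ℂ) ^ n * z)‖ = 1 := by rw [← sub_eq_zero.1 h1, norm_one]
      rw [norm_mul, Complex.norm_real, Real.norm_of_nonneg ha0] at h2
      nlinarith [norm_nonneg ((q : ℂ) ^ n * z)]
  obtain ⟨M, -, hM⟩ := exists_norm_heineCoeff_le hq0 hq1 le_rfl one_pos
  have hM' := hM a 0 0 ha0 haq le_rfl (by simp) le_rfl le_rfl
  have hy : Tendsto (fun n : ℕ => (q : ℂ) ^ n * z) atTop (𝓝 0) := by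
    have : Tendsto (fun n : ℕ => (q : ℂ) ^ n) atTop (𝓝 0) :=
      tendsto_pow_atTop_nhds_zero_of_norm_lt_one
        (by rwa [Complex.norm_real, Real.norm_of_nonneg hq0.le])
    simpa using this.mul_const z
  have := tendsto_tsum_mul_pow_of_bounded (u := fun _ n => heineCoeff a (0 : ℝ) (0 : ℝ) q n)
    (fun _ n => hM' n) hn hz (fun n => tendsto_const_nhds) hy
  simp only [Complex.ofReal_zero, ← heinePhi_eq_tsum, hall, heinePhi_zero] at this
  exact zero_ne_one (tendsto_nhds_unique tendsto_const_nhds this)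

theorem heinePhi_self {a b q : ℝ} (hq0 : 0 < q) (hq1 : q < 1) (hb0 : 0 ≤ b) (hb1 : b < 1) (z : ℂ) :
    heinePhi a b b q z = heinePhi a 0 0 q z := by
  simp only [heinePhi_eq_tsum]
  refine tsum_congr fun n => ?_
  have := watsonSymbol_ne_zero hq0 hq1 hb0 hb1 n
  simp only [heineCoeff, watsonSymbol_zero_left]
  rw [mul_comm (watsonSymbol (a : ℂ) q n), mul_div_mul_left _ _ this, mul_one, one_mul]

/-! ### Heine's continued fraction -/

/-- The numerator parameters along Heine's continued fraction: `b, a, bq, aq, bq², aq², …`. -/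
noncomputable def heineParam (q a b : ℝ) : ℕ → ℝ
  | 0 => b
  | 1 => a
  | n + 2 => heineParam q a b n * q

/-- The functions occurring in Heine's continued fraction: `Φ[a,b;c]`, `Φ[a,bq;cq]`,
`Φ[aq,bq;cq²]`, … -/
noncomputable def heineChain (q a b c : ℝ) (n : ℕ) (x : ℂ) : ℂ :=
  heinePhi (heineParam q a b (n + 1) : ℝ) (heineParam q a b n : ℝ) (c * q ^ n : ℝ) q x

/-- The parameters of Heine's continued fraction, written as a `g`-fraction. -/
noncomputable def heineG (q a b c : ℝ) (n : ℕ) : ℝ :=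
  (heineParam q a b (n + 1) - c * q ^ n) / (1 - c * q ^ n)

section
variable {q a b c : ℝ}

theorem heineParam_nonneg (hq0 : 0 < q) (ha0 : 0 ≤ a) (hb0 : 0 ≤ b) :
    ∀ n, 0 ≤ heineParam q a b n
  | 0 => hb0
  | 1 => ha0
  | n + 2 => mul_nonneg (heineParam_nonneg hq0 ha0 hb0 n) hq0.le

/-- The index starts at 1 because the parameter `b` at index 0 may exceed 1. -/
theorem heineParam_succ_le_one (hq0 : 0 < q) (hq1 : q < 1) (ha1 : a ≤ 1) (hb1 : b * q ≤ 1) :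
    ∀ n, heineParam q a b (n + 1) ≤ 1
  | 0 => ha1
  | 1 => hb1
  | n + 2 => by
    have := heineParam_succ_le_one hq0 hq1 ha1 hb1 n
    rw [heineParam]
    nlinarith

theorem heineParam_mul_le_one (hq0 : 0 < q) (hq1 : q < 1) (ha1 : a ≤ 1) (hb1 : b * q ≤ 1)
    (n : ℕ) : heineParam q a b n * q ≤ 1 := by
  have := heineParam_succ_le_one hq0 hq1 ha1 hb1 (n + 1)
  rwa [heineParam] at this

theorem le_heineParam (hq0 : 0 < q) (hq1 : q < 1) (hc0 : 0 ≤ c) (hac : c ≤ a) (hbc : c ≤ b) :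
    ∀ n, c * q ^ n ≤ heineParam q a b n ∧ c * q ^ n ≤ heineParam q a b (n + 1)
  | 0 => by simpa [heineParam] using ⟨hbc, hac⟩
  | n + 1 => by
    obtain ⟨h1, h2⟩ := le_heineParam hq0 hq1 hc0 hac hbc n
    have h3 : c * q ^ (n + 1) = c * q ^ n * q := by ring
    have h0 : 0 ≤ c * q ^ n := by positivity
    rw [heineParam, h3]
    exact ⟨le_trans (by nlinarith) h2, mul_le_mul_of_nonneg_right h1 hq0.le⟩

theorem tendsto_heineParam (hq0 : 0 < q) (hq1 : q < 1) (ha0 : 0 ≤ a) (hb0 : 0 ≤ b) :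
    Tendsto (heineParam q a b) atTop (𝓝 0) := by
  have hs : 0 < √q := Real.sqrt_pos.2 hq0
  have hsq : √q * √q = q := Real.mul_self_sqrt hq0.le
  have hs1 : √q < 1 := by rw [Real.sqrt_lt' one_pos]; simpa
  -- Two steps multiply by `q`, so the rate is `√q` per step; the constant dominates both initial
  -- values.
  have hbd : ∀ n, heineParam q a b n ≤ (b + a / √q) * √q ^ n ∧
      heineParam q a b (n + 1) ≤ (b + a / √q) * √q ^ (n + 1) := by
    intro n
    induction n with
    | zero =>
      have h1 : (b + a / √q) * √q = b * √q + a := by field_simp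
      simp only [heineParam, pow_zero, mul_one, zero_add, pow_one, h1]
      constructor
      · have : 0 ≤ a / √q := by positivity
        linarith
      · have : 0 ≤ b * √q := by positivity
        linarith
    | succ n ih =>
      refine ⟨ih.2, ?_⟩
      rw [heineParam]
      calc _ ≤ (b + a / √q) * √q ^ n * q := mul_le_mul_of_nonneg_right ih.1 hq0.le
        _ = (b + a / √q) * √q ^ n * (√q * √q) := by rw [hsq]
        _ = _ := by ring
  refine squeeze_zero (heineParam_nonneg hq0 ha0 hb0) (fun n => (hbd n).1) ?_
  simpa using (tendsto_pow_atTop_nhds_zero_of_lt_one hs.le hs1).const_mul (b + a / √q)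

theorem one_sub_le_one_sub_mul_pow (hq0 : 0 < q) (hq1 : q < 1) (hc0 : 0 ≤ c) (n : ℕ) :
    1 - c ≤ 1 - c * q ^ n := by
  have := mul_le_of_le_one_right hc0 (pow_le_one₀ (n := n) hq0.le hq1.le)
  linarith

/-- This is what the parameter restrictions are for: every parameter after the first lies between
the corresponding `c q^n` and 1. -/
theorem heineG_mem (hq0 : 0 < q) (hq1 : q < 1) (ha1 : a ≤ 1) (hb1 : b * q ≤ 1)
    (hc0 : 0 ≤ c) (hc1 : c < 1) (hac : c ≤ a) (hbc : c ≤ b) (n : ℕ) :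
    0 ≤ heineG q a b c n ∧ heineG q a b c n ≤ 1 := by
  have h1 : 0 < 1 - c * q ^ n := lt_of_lt_of_le (by linarith) (one_sub_le_one_sub_mul_pow hq0 hq1 hc0 n)
  have h2 := heineParam_succ_le_one hq0 hq1 ha1 hb1 n
  have h3 := (le_heineParam hq0 hq1 hc0 hac hbc n).2
  refine ⟨div_nonneg (by linarith) h1.le, ?_⟩
  rw [heineG, div_le_one h1]
  linarith

theorem heineG_le (hq0 : 0 < q) (hq1 : q < 1) (ha0 : 0 ≤ a) (hb0 : 0 ≤ b)
    (hc0 : 0 ≤ c) (hc1 : c < 1) (n : ℕ) :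
    heineG q a b c n ≤ heineParam q a b (n + 1) / (1 - c) := by
  have h0 : 0 ≤ c * q ^ n := by positivity
  exact div_le_div₀ (heineParam_nonneg hq0 ha0 hb0 _) (by linarith) (by linarith)
    (one_sub_le_one_sub_mul_pow hq0 hq1 hc0 n)

/-- Three-term recurrence behind Heine's continued fraction. -/
theorem heineChain_recurrence (hq0 : 0 < q) (hq1 : q < 1) (ha0 : 0 ≤ a) (ha1 : a ≤ 1) (hb0 : 0 ≤ b)
    (hb1 : b * q ≤ 1) (hc0 : 0 ≤ c) (hc1 : c < 1) {z : ℂ} (hz : ‖(q : ℂ) * z‖ < 1) (n : ℕ) :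
    heineChain q a b c (n + 1) (q * z) - heineChain q a b c n (q * z) =
      (((1 - heineG q a b c n) * heineG q a b c (n + 1) : ℝ) : ℂ) * z *
        heineChain q a b c (n + 2) (q * z) := by
  have hcn : c * q ^ n < 1 := by linarith [one_sub_le_one_sub_mul_pow hq0 hq1 hc0 n]
  have hcn' : c * q ^ (n + 1) < 1 := by linarith [one_sub_le_one_sub_mul_pow hq0 hq1 hc0 (n + 1)]
  have key := heinePhi_contiguous hq0 hq1
    (heineParam_nonneg hq0 ha0 hb0 (n + 1)) (heineParam_mul_le_one hq0 hq1 ha1 hb1 (n + 1))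
    (heineParam_nonneg hq0 ha0 hb0 n) (heineParam_mul_le_one hq0 hq1 ha1 hb1 n)
    (c := c * q ^ n) (by positivity) hcn hz
  have e1 : heineChain q a b c (n + 1) (q * z) =
      heinePhi (heineParam q a b (n + 1) : ℝ) (heineParam q a b n * q) ((c * q ^ n : ℝ) * q) q
        (q * z) := by
    rw [heineChain, heinePhi_comm, heineParam]
    congr 1 <;> push_cast <;> ring
  have e2 : heineChain q a b c (n + 2) (q * z) =
      heinePhi (heineParam q a b (n + 1) * q) (heineParam q a b n * q) ((c * q ^ n : ℝ) * q * q) q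
        (q * z) := by
    rw [heineChain, heineParam, heineParam]
    congr 1 <;> push_cast <;> ring
  rw [e1, e2, heineChain, key]
  congr 1
  rw [heineG, heineG, heineParam]
  have h1 : (1 - c * q ^ n : ℂ) ≠ 0 := by exact_mod_cast (sub_pos.2 hcn).ne'
  have h2 : (1 - c * q ^ n * q : ℂ) ≠ 0 := by
    have : (1 - c * q ^ (n + 1) : ℂ) ≠ 0 := by exact_mod_cast (sub_pos.2 hcn').ne'
    rwa [pow_succ, ← mul_assoc] at this
  push_cast
  rw [one_sub_div h1, show (c * q ^ (n + 1) : ℂ) = c * q ^ n * q by ring]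
  generalize (c * q ^ n : ℂ) = p at *
  generalize hr : (p * q : ℂ) = r at *
  field_simp
  rw [← hr]
  ring

/-- The coefficient bound is uniform in the parameters, hence along the chain; this puts the
rescaled chain in ℓ². -/
theorem exists_norm_heineChain_le (hq0 : 0 < q) (hq1 : q < 1) (ha0 : 0 ≤ a) (ha1 : a ≤ 1)
    (hb0 : 0 ≤ b) (hb1 : b * q ≤ 1) (hc0 : 0 ≤ c) (hc1 : c < 1) {x : ℂ} (hx : ‖x‖ < 1) :
    ∃ B, ∀ n, ‖heineChain q a b c n x‖ ≤ B := by
  obtain ⟨M, hM0, hM⟩ := exists_norm_heineCoeff_le hq0 hq1 hc0 hc1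
  refine ⟨∑' n : ℕ, M * ‖x‖ ^ n, fun n => ?_⟩
  rw [heineChain, heinePhi_eq_tsum]
  refine tsum_of_norm_bounded
    ((summable_geometric_of_lt_one (norm_nonneg x) hx).mul_left M).hasSum fun k => ?_
  rw [norm_mul, norm_pow]
  refine mul_le_mul_of_nonneg_right (hM _ _ _ (heineParam_nonneg hq0 ha0 hb0 (n + 1))
    (heineParam_mul_le_one hq0 hq1 ha1 hb1 (n + 1)) (heineParam_nonneg hq0 ha0 hb0 n)
    (heineParam_mul_le_one hq0 hq1 ha1 hb1 n) (by positivity) ?_ k) (by positivity)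
  linarith [one_sub_le_one_sub_mul_pow hq0 hq1 hc0 n]

theorem tendsto_heineChain (hq0 : 0 < q) (hq1 : q < 1) (ha0 : 0 ≤ a) (ha1 : a ≤ 1)
    (hb0 : 0 ≤ b) (hb1 : b * q ≤ 1) (hc0 : 0 ≤ c) (hc1 : c < 1) {x : ℂ} (hx : ‖x‖ < 1) :
    Tendsto (fun n => heineChain q a b c n x) atTop (𝓝 (heinePhi 0 0 0 q x)) := by
  obtain ⟨M, hM0, hM⟩ := exists_norm_heineCoeff_le hq0 hq1 hc0 hc1
  have hp : Tendsto (fun n => (heineParam q a b n : ℂ)) atTop (𝓝 ((0 : ℝ) : ℂ)) :=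
    (Complex.continuous_ofReal.tendsto 0).comp (tendsto_heineParam hq0 hq1 ha0 hb0)
  have hcq : Tendsto (fun n : ℕ => ((c * q ^ n : ℝ) : ℂ)) atTop (𝓝 ((0 : ℝ) : ℂ)) := by
    refine (Complex.continuous_ofReal.tendsto 0).comp ?_
    simpa using (tendsto_pow_atTop_nhds_zero_of_lt_one hq0.le hq1).const_mul c
  rw [Complex.ofReal_zero] at hp hcq
  have hw : ∀ {f : ℕ → ℂ} (k : ℕ), Tendsto f atTop (𝓝 0) →
      Tendsto (fun n => watsonSymbol (f n) q k) atTop (𝓝 (watsonSymbol 0 q k)) :=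
    fun k h => ((continuous_watsonSymbol q k).tendsto 0).comp h
  refine tendsto_tsum_mul_pow_of_bounded
    (u := fun n k => heineCoeff (heineParam q a b (n + 1) : ℝ) (heineParam q a b n : ℝ)
      (c * q ^ n : ℝ) q k) (M := M) (r := ‖x‖) (fun n k => ?_) (fun _ => le_rfl) hx (fun k => ?_)
    tendsto_const_nhds
  · refine hM _ _ _ (heineParam_nonneg hq0 ha0 hb0 (n + 1))
      (heineParam_mul_le_one hq0 hq1 ha1 hb1 (n + 1)) (heineParam_nonneg hq0 ha0 hb0 n)
      (heineParam_mul_le_one hq0 hq1 ha1 hb1 n) (by positivity) ?_ k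
    linarith [one_sub_le_one_sub_mul_pow hq0 hq1 hc0 n]
  · refine ((hw k (hp.comp (tendsto_add_atTop_nat 1))).mul (hw k hp)).div
      ((hw k hcq).mul tendsto_const_nhds) (mul_ne_zero ?_ ?_)
    · simp [watsonSymbol_zero_left]
    · exact watsonSymbol_ne_zero hq0 hq1 hq0.le hq1 k

/-- Two consecutive functions of Heine's chain have no common zero. -/
theorem heineChain_zero_ne_zero (hq0 : 0 < q) (hq1 : q < 1) (ha1 : a ≤ 1)
    (hb1 : b * q ≤ 1) (hc0 : 0 ≤ c) (hac : c < a) (hbc : c ≤ b) {z : ℂ}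
    (hz : ‖(q : ℂ) * z‖ < 1)
    (h01 : heineChain q a b c 0 (q * z) = 0 → heineChain q a b c 1 (q * z) = 0) :
    heineChain q a b c 0 (q * z) ≠ 0 := by
  intro h0
  have h1 := h01 h0
  have hc1 : c < 1 := hac.trans_le ha1
  have ha0 : 0 ≤ a := hc0.trans hac.le
  have hb0 : 0 ≤ b := hc0.trans hbc
  -- The cases `a = 1`, `bq = 1` and `b = c` make `g 0 = 1`, `g 1 = 1` and `g 1 = 0`. A recurrence
  -- coefficient then vanishes and zeros cannot be propagated, but one of the first two functions is
  -- constant or a q-binomial series.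
  rcases ha1.eq_or_lt with rfl | ha1'
  · refine one_ne_zero (h0.symm.trans ?_).symm
    simp [heineChain, heineParam, heinePhi_one_left]
  rcases hb1.eq_or_lt with hb1' | hb1'
  · refine one_ne_zero (h1.symm.trans ?_).symm
    simp only [heineChain, heineParam, hb1', Complex.ofReal_one]
    exact heinePhi_one_left _ _ _ _
  rcases hbc.eq_or_lt with rfl | hbc'
  · refine qBinomial_ne_zero hq0 hq1 ha0 ha1 hz ?_
    rw [← heinePhi_self hq0 hq1 hc0 hc1, ← h0]
    simp [heineChain, heineParam]
  have hz0 : z ≠ 0 := by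
    rintro rfl
    simp [heineChain, heinePhi_zero] at h0
  have hlt : ∀ n, c * q ^ n < heineParam q a b n ∧ c * q ^ n < heineParam q a b (n + 1) := by
    intro n
    induction n with
    | zero => simpa [heineParam] using ⟨hbc', hac⟩
    | succ n ih =>
      have h3 : c * q ^ (n + 1) = c * q ^ n * q := by ring
      have h0 : 0 ≤ c * q ^ n := by positivity
      rw [heineParam, h3]
      exact ⟨lt_of_le_of_lt (by nlinarith) ih.2, mul_lt_mul_of_pos_right ih.1 hq0⟩
  have hlt1 : ∀ n, heineParam q a b (n + 1) < 1 ∧ heineParam q a b (n + 2) < 1 := by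
    intro n
    induction n with
    | zero => exact ⟨ha1', hb1'⟩
    | succ n ih =>
      refine ⟨ih.2, ?_⟩
      rw [heineParam]
      have := heineParam_nonneg hq0 ha0 hb0 (n + 1)
      nlinarith
  have hg : ∀ n, 0 < heineG q a b c n ∧ heineG q a b c n < 1 := by
    intro n
    have h1 : 0 < 1 - c * q ^ n :=
      lt_of_lt_of_le (by linarith) (one_sub_le_one_sub_mul_pow hq0 hq1 hc0 n)
    refine ⟨div_pos (by linarith [(hlt n).2]) h1, ?_⟩
    rw [heineG, div_lt_one h1]
    linarith [(hlt1 n).1]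
  have hall : ∀ n, heineChain q a b c n (q * z) = 0 ∧ heineChain q a b c (n + 1) (q * z) = 0 := by
    intro n
    induction n with
    | zero => exact ⟨h0, h1⟩
    | succ n ih =>
      refine ⟨ih.2, ?_⟩
      have h := heineChain_recurrence hq0 hq1 ha0 ha1 hb0 hb1 hc0 hc1 hz n
      rw [ih.1, ih.2, sub_zero] at h
      refine (mul_eq_zero.1 h.symm).resolve_left (mul_ne_zero ?_ hz0)
      exact Complex.ofReal_ne_zero.2 (mul_pos (sub_pos.2 (hg n).2) (hg (n + 1)).1).ne'
  have hlim := tendsto_heineChain hq0 hq1 ha0 ha1 hb0 hb1 hc0 hc1 hz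
  simp only [fun n => (hall n).1] at hlim
  have := qBinomial_ne_zero hq0 hq1 le_rfl zero_le_one hz
  rw [Complex.ofReal_zero] at this
  exact this (tendsto_nhds_unique hlim tendsto_const_nhds)

end

theorem integrable_of_continuousOn_Icc {E : Type*} [NormedAddCommGroup E] {ν : Measure ℝ}
    [IsFiniteMeasure ν] {a b : ℝ} (hν : ν (Icc a b)ᶜ = 0) {f : ℝ → E}
    (hf : ContinuousOn f (Icc a b)) : Integrable f ν := by
  have hr : ν.restrict (Icc a b) = ν := Measure.restrict_eq_self_of_ae_mem hν
  rw [← hr]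
  exact hf.integrableOn_compact isCompact_Icc

/-! ### Spectral measure of a self-adjoint contraction -/

section
variable {E : Type*} [NormedAddCommGroup E] [InnerProductSpace ℂ E] [CompleteSpace E]

theorem spectrum_subset_Icc_of_norm_le_one {J : E →L[ℂ] E} (hn : ‖J‖ ≤ 1) :
    spectrum ℝ J ⊆ Icc (-1) 1 := by
  intro x hx
  have h := spectrum.norm_le_norm_mul_of_mem hx
  have h1 : ‖(1 : E →L[ℂ] E)‖ ≤ 1 := ContinuousLinearMap.norm_id_le
  rw [Real.norm_eq_abs] at h
  exact abs_le.1 (h.trans ((mul_le_mul hn h1 (norm_nonneg _) zero_le_one).trans (one_mul 1).le))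

/-- The positive functional `f ↦ ⟪e, f(J) e⟫`. -/
noncomputable def spectralFunctional (J : E →L[ℂ] E) (hJ : IsSelfAdjoint J) (e : E) :
    C_c(spectrum ℝ J, ℝ) →ₚ[ℝ] ℝ :=
  PositiveLinearMap.mk₀
    { toFun := fun f => (⟪e, cfcHom hJ (f : C(spectrum ℝ J, ℝ)) e⟫_ℂ).re
      map_add' := fun f g => by
        rw [show ((f + g : C_c(spectrum ℝ J, ℝ)) : C(spectrum ℝ J, ℝ)) = f + g from rfl]
        simp
      map_smul' := fun r f => by
        rw [show ((r • f : C_c(spectrum ℝ J, ℝ)) : C(spectrum ℝ J, ℝ)) =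
          r • (f : C(spectrum ℝ J, ℝ)) from rfl]
        rw [map_smul, smul_apply, ← Complex.coe_smul, inner_smul_right]
        simp }
    fun f hf => by
      have h : 0 ≤ cfcHom hJ (f : C(spectrum ℝ J, ℝ)) := cfcHom_nonneg_iff hJ |>.2 hf
      rw [ContinuousLinearMap.nonneg_iff_isPositive] at h
      exact (Complex.le_def.1 (h.inner_nonneg_right e)).1

theorem inner_cfc_im (J : E →L[ℂ] E) (e : E) (f : ℝ → ℝ) : (⟪e, cfc f J e⟫_ℂ).im = 0 := by
  have h : IsSelfAdjoint (cfc f J) := cfc_predicate f J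
  have h1 : ⟪e, cfc f J e⟫_ℂ = conj ⟪e, cfc f J e⟫_ℂ := by
    rw [inner_conj_symm]
    exact (h.isSymmetric e e).symm
  exact Complex.conj_eq_iff_im.1 h1.symm

/-- A self-adjoint contraction has a spectral measure at every unit vector. -/
theorem exists_spectralMeasure {J : E →L[ℂ] E} (hJ : IsSelfAdjoint J) (hn : ‖J‖ ≤ 1) {e : E}
    (he : ‖e‖ = 1) :
    ∃ ν : Measure ℝ, IsProbabilityMeasure ν ∧ ν (Icc (-1) 1)ᶜ = 0 ∧
      ∀ f : ℝ → ℝ, ContinuousOn f (Icc (-1) 1) →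
        ⟪e, cfc f J e⟫_ℂ = ((∫ x, f x ∂ν : ℝ) : ℂ) := by
  have hcpt : CompactSpace (spectrum ℝ J) := isCompact_iff_compactSpace.1 (spectrum.isCompact J)
  have hsub := spectrum_subset_Icc_of_norm_le_one hn
  set ρ := RealRMK.rieszMeasure (spectralFunctional J hJ e) with hρ
  have hemb : MeasurableEmbedding (Subtype.val : spectrum ℝ J → ℝ) :=
    MeasurableEmbedding.subtype_coe (spectrum.isClosed J).measurableSet
  have key : ∀ f : ℝ → ℝ, ContinuousOn f (Icc (-1) 1) →
      ⟪e, cfc f J e⟫_ℂ = ((∫ x, f x ∂(ρ.map Subtype.val) : ℝ) : ℂ) := by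
    intro f hf
    have hf' : ContinuousOn f (spectrum ℝ J) := hf.mono hsub
    -- The spectrum is compact, so every continuous function on it has compact support and the Riesz
    -- representation applies.
    have h := RealRMK.integral_rieszMeasure (spectralFunctional J hJ e)
      (CompactlySupportedContinuousMap.continuousMapEquiv ⟨_, hf'.domRestrict⟩)
    rw [hemb.integral_map]
    refine Complex.ext ?_ (by rw [inner_cfc_im, Complex.ofReal_im])
    rw [Complex.ofReal_re, cfc_apply f J hJ hf']
    exact h.symm
  have huniv : (ρ.map Subtype.val).real univ = 1 := by
    have h := key (fun _ => 1) continuousOn_const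
    rw [cfc_const_one ℝ J] at h
    rw [integral_const, smul_eq_mul, mul_one] at h
    have h2 : ⟪e, (1 : E →L[ℂ] E) e⟫_ℂ = 1 := by
      rw [one_apply_eq_self, inner_self_eq_norm_sq_to_K, he]
      simp
    rw [h2] at h
    exact_mod_cast h.symm
  refine ⟨ρ.map Subtype.val, ⟨?_⟩, ?_, key⟩
  · rwa [measureReal_def, ENNReal.toReal_eq_one_iff] at huniv
  · rw [hemb.map_apply]
    convert measure_empty (μ := ρ)
    ext x
    simpa using hsub x.2

theorem continuousOn_inv_normSq {w : ℂ} (hw : ∀ l ∈ Icc (-1 : ℝ) 1, (1 - w * l : ℂ) ≠ 0) :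
    ContinuousOn (fun l : ℝ => (Complex.normSq (1 - w * l))⁻¹) (Icc (-1) 1) := by
  refine ContinuousOn.inv₀ ?_ fun l hl => (Complex.normSq_pos.2 (hw l hl)).ne'
  exact (Complex.continuous_normSq.comp (by fun_prop)).continuousOn

/-- The resolvent of a self-adjoint contraction in terms of its spectral measure. -/
theorem inner_eq_integral_of_resolvent {J : E →L[ℂ] E} (hJ : IsSelfAdjoint J) (hn : ‖J‖ ≤ 1)
    {e : E} {ν : Measure ℝ} [IsProbabilityMeasure ν] (hν : ν (Icc (-1) 1)ᶜ = 0)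
    (h : ∀ f : ℝ → ℝ, ContinuousOn f (Icc (-1) 1) →
        ⟪e, cfc f J e⟫_ℂ = ((∫ x, f x ∂ν : ℝ) : ℂ))
    {w : ℂ} (hw : ∀ l ∈ Icc (-1 : ℝ) 1, (1 - w * l : ℂ) ≠ 0) {x : E} {φ : ℂ}
    (hx : x - w • J x = φ • e) :
    ⟪e, x⟫_ℂ = φ * ∫ l : ℝ, 1 / (1 - w * l) ∂ν := by
  have hsub := spectrum_subset_Icc_of_norm_le_one hn
  -- The functional calculus used here takes real functions, so the resolvent is written as `k(J)(1
  -- - conj w • J)` with the real function `k = |1 - wl|⁻²`.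
  set k : ℝ → ℝ := fun l => (Complex.normSq (1 - w * l))⁻¹ with hk
  have hkc : ContinuousOn k (Icc (-1) 1) := continuousOn_inv_normSq hw
  have hkc' := hkc.mono hsub
  have hkid : ContinuousOn (fun l => k l * l) (Icc (-1) 1) := hkc.mul continuousOn_id
  have hKJ : cfc k J * J = cfc (fun l => k l * l) J := by
    conv_lhs => rw [← cfc_id' ℝ J, cfc_id' ℝ J]
    rw [cfc_mul k (fun l => l) J hkc' continuousOn_id, cfc_id' ℝ J]
  have hinv : cfc k J * ((1 - conj w • J) * (1 - w • J)) = 1 := by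
    have h1 : (1 - conj w • J) * (1 - w • J) =
        cfc (fun l : ℝ => 1 - (2 * w.re) * l + Complex.normSq w * (l * l)) J := by
      rw [cfc_add (a := J) (fun l : ℝ => 1 - (2 * w.re) * l) (fun l => Complex.normSq w * (l * l))
          (by fun_prop) (by fun_prop),
        cfc_sub (fun _ : ℝ => (1 : ℝ)) (fun l => (2 * w.re) * l) J (by fun_prop) (by fun_prop),
        cfc_const_one ℝ J, cfc_const_mul (2 * w.re) (fun l => l) J (by fun_prop),
        cfc_const_mul (Complex.normSq w) (fun l => l * l) J (by fun_prop),
        cfc_mul (fun l : ℝ => l) (fun l => l) J (by fun_prop) (by fun_prop), cfc_id' ℝ J]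
      rw [mul_sub, sub_mul, sub_mul, one_mul, mul_one, one_mul, smul_mul_smul_comm,
        mul_comm (conj w), Complex.mul_conj, ← Complex.coe_smul, ← Complex.coe_smul]
      have : ((2 * w.re : ℝ) : ℂ) = w + conj w := (Complex.add_conj w).symm
      rw [this, add_smul]
      abel
    rw [h1, ← cfc_mul k _ J hkc' (by fun_prop), ← cfc_const_one ℝ J]
    refine cfc_congr fun l hl => ?_
    have h2 : 1 - (2 * w.re) * l + Complex.normSq w * (l * l) = Complex.normSq (1 - w * l) := by
      simp [Complex.normSq_apply]
      ring
    simp only [h2]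
    exact inv_mul_cancel₀ (Complex.normSq_pos.2 (hw l (hsub hl))).ne'
  have hx' : x = φ • (cfc k J e - conj w • cfc (fun l => k l * l) J e) := by
    calc x = (cfc k J * ((1 - conj w • J) * (1 - w • J))) x := by rw [hinv]; rfl
      _ = (cfc k J) ((1 - conj w • J) (x - w • J x)) := rfl
      _ = (cfc k J) ((1 - conj w • J) (φ • e)) := by rw [hx]
      _ = φ • (cfc k J e - conj w • (cfc k J * J) e) := by
        rw [map_smul, map_smul, sub_apply, map_sub,
          smul_apply, map_smul]
        rfl
      _ = _ := by rw [hKJ]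
  rw [hx', inner_smul_right, inner_sub_right, inner_smul_right, h k hkc, h _ hkid,
    ← integral_complex_ofReal, ← integral_complex_ofReal, ← integral_const_mul,
    ← integral_sub (integrable_of_continuousOn_Icc hν hkc).ofReal
      ((integrable_of_continuousOn_Icc hν hkid).ofReal.const_mul _)]
  congr 1
  refine integral_congr_ae ?_
  filter_upwards [show ∀ᵐ l ∂ν, l ∈ Icc (-1 : ℝ) 1 from hν] with l hl
  have h1 := hw l hl
  have h2 : ((k l : ℝ) : ℂ) = ((1 - w * l) * conj (1 - w * l))⁻¹ := by
    rw [Complex.mul_conj, hk, Complex.ofReal_inv]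
  have h3 : conj (1 - w * l) = 1 - conj w * l := by simp
  have h4 : (1 - conj w * l : ℂ) ≠ 0 := by
    rw [← h3]
    exact (map_ne_zero (starRingEnd ℂ)).2 h1
  push_cast
  rw [h2, h3]
  generalize conj w = v at *
  rw [one_div, mul_inv]
  linear_combination (1 - w * l : ℂ)⁻¹ * mul_inv_cancel₀ h4

end

/-! ### Jacobi operators of `g`-fractions -/

/-- The Hilbert space of square summable sequences. -/
abbrev SeqHilbert : Type := lp (fun _ : ℕ => ℂ) 2

theorem SeqHilbert.hasSum_norm_sq (x : SeqHilbert) : HasSum (fun n => ‖x n‖ ^ 2) (‖x‖ ^ 2) := by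
  have h := lp.hasSum_norm (by norm_num) x
  simpa using h

theorem SeqHilbert.norm_le_of_hasSum_le {x y : SeqHilbert} {u : ℕ → ℝ} (hu : Summable u)
    (h : ∀ n, ‖x n‖ ^ 2 ≤ u n) (hy : ∑' n, u n ≤ ‖y‖ ^ 2) : ‖x‖ ≤ ‖y‖ := by
  refine le_of_sq_le_sq ?_ (norm_nonneg y)
  exact ((hasSum_le h x.hasSum_norm_sq hu.hasSum)).trans hy

theorem memℓp_two_of_summable {f : ℕ → ℂ} (hf : Summable fun n => ‖f n‖ ^ 2) : Memℓp f 2 := by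
  refine memℓp_gen ?_
  simpa using hf

theorem norm_sq_mul_le {s : ℝ} (hs : |s| ≤ 1) (x : ℂ) : ‖(s : ℂ) * x‖ ^ 2 ≤ ‖x‖ ^ 2 := by
  rw [norm_mul, Complex.norm_real, Real.norm_eq_abs]
  exact pow_le_pow_left₀ (by positivity) (mul_le_of_le_one_left (norm_nonneg x) hs) 2

/-- The weighted backward shift `(x₀, x₁, …) ↦ (s₀ x₁, s₁ x₂, …)`. -/
noncomputable def backwardShift (s : ℕ → ℝ) (hs : ∀ n, |s n| ≤ 1) : SeqHilbert →L[ℂ] SeqHilbert :=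
  LinearMap.mkContinuous
    { toFun := fun x => ⟨fun n => (s n : ℂ) * x (n + 1), memℓp_two_of_summable
        (((summable_nat_add_iff 1).2 x.hasSum_norm_sq.summable).of_nonneg_of_le
          (fun n => by positivity) fun n => norm_sq_mul_le (hs n) _)⟩
      map_add' := fun x y => by
        ext n
        exact mul_add _ _ _
      map_smul' := fun r x => by
        ext n
        exact mul_left_comm _ _ _ } 1 fun x => by
    rw [one_mul]
    refine SeqHilbert.norm_le_of_hasSum_le ((summable_nat_add_iff 1).2 x.hasSum_norm_sq.summable)
      (fun n => norm_sq_mul_le (hs n) _) ?_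
    rw [← x.hasSum_norm_sq.tsum_eq, x.hasSum_norm_sq.summable.tsum_eq_zero_add]
    exact le_add_of_nonneg_left (by positivity)

theorem backwardShift_apply (s : ℕ → ℝ) (hs : ∀ n, |s n| ≤ 1) (x : SeqHilbert) (n : ℕ) :
    backwardShift s hs x n = s n * x (n + 1) := rfl

theorem backwardShift_single (s : ℕ → ℝ) (hs : ∀ n, |s n| ≤ 1) (n : ℕ) :
    backwardShift s hs (lp.single 2 (n + 1) 1) = (s n : ℂ) • lp.single 2 n 1 := by
  ext k
  rw [backwardShift_apply, lp.coeFn_smul, Pi.smul_apply, smul_eq_mul]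
  rcases eq_or_ne k n with rfl | h
  · simp
  · simp [h]

theorem adjoint_backwardShift_zero (s : ℕ → ℝ) (hs : ∀ n, |s n| ≤ 1) (x : SeqHilbert) :
    (backwardShift s hs).adjoint x 0 = 0 := by
  have h : backwardShift s hs (lp.single 2 0 1) = 0 := by
    ext k
    rw [backwardShift_apply]
    simp
  have h1 := ContinuousLinearMap.adjoint_inner_right (backwardShift s hs) (lp.single 2 0 1) x
  rw [h, inner_zero_left, lp.inner_single_left] at h1
  simpa using h1

theorem adjoint_backwardShift_succ (s : ℕ → ℝ) (hs : ∀ n, |s n| ≤ 1) (x : SeqHilbert) (n : ℕ) :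
    (backwardShift s hs).adjoint x (n + 1) = s n * x n := by
  have h1 := ContinuousLinearMap.adjoint_inner_right (backwardShift s hs)
    (lp.single 2 (n + 1) 1) x
  rw [backwardShift_single, inner_smul_left, lp.inner_single_left, lp.inner_single_left] at h1
  simpa using h1

/-- The Jacobi operator with zero diagonal and off-diagonal entries `s₀, s₁, …`. -/
noncomputable def jacobiOperator (s : ℕ → ℝ) (hs : ∀ n, |s n| ≤ 1) : SeqHilbert →L[ℂ] SeqHilbert :=
  backwardShift s hs + (backwardShift s hs).adjoint

theorem jacobiOperator_zero (s : ℕ → ℝ) (hs : ∀ n, |s n| ≤ 1) (x : SeqHilbert) :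
    jacobiOperator s hs x 0 = s 0 * x 1 := by
  change backwardShift s hs x 0 + (backwardShift s hs).adjoint x 0 = _
  rw [adjoint_backwardShift_zero, add_zero, backwardShift_apply]

theorem jacobiOperator_succ (s : ℕ → ℝ) (hs : ∀ n, |s n| ≤ 1) (x : SeqHilbert) (n : ℕ) :
    jacobiOperator s hs x (n + 1) = s (n + 1) * x (n + 2) + s n * x n := by
  change backwardShift s hs x (n + 1) + (backwardShift s hs).adjoint x (n + 1) = _
  rw [adjoint_backwardShift_succ, backwardShift_apply]

theorem isSelfAdjoint_jacobiOperator (s : ℕ → ℝ) (hs : ∀ n, |s n| ≤ 1) :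
    IsSelfAdjoint (jacobiOperator s hs) := by
  rw [jacobiOperator, ← ContinuousLinearMap.star_eq_adjoint]
  exact IsSelfAdjoint.add_star_self _

/-- Cauchy–Schwarz against the unit vector `(√(1 - g'), √g')`. -/
theorem norm_sq_sqrt_combination_le {g g' g'' : ℝ} (hg : g ≤ 1) (hg0 : 0 ≤ g') (hg1 : g' ≤ 1)
    (hg'' : 0 ≤ g'') (x y : ℂ) :
    ‖(√((1 - g') * g'') : ℂ) * x + (√((1 - g) * g') : ℂ) * y‖ ^ 2 ≤
      g'' * ‖x‖ ^ 2 + (1 - g) * ‖y‖ ^ 2 := by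
  have h1 : 0 ≤ 1 - g' := by linarith
  have h2 : 0 ≤ 1 - g := by linarith
  have h3 : ‖(√((1 - g') * g'') : ℂ) * x + (√((1 - g) * g') : ℂ) * y‖ ≤
      √(1 - g') * (√g'' * ‖x‖) + √g' * (√(1 - g) * ‖y‖) := by
    refine (norm_add_le _ _).trans (le_of_eq ?_)
    rw [norm_mul, norm_mul, Complex.norm_real, Complex.norm_real,
      Real.norm_of_nonneg (Real.sqrt_nonneg _), Real.norm_of_nonneg (Real.sqrt_nonneg _),
      Real.sqrt_mul h1, Real.sqrt_mul h2]
    ring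
  refine (pow_le_pow_left₀ (norm_nonneg _) h3 2).trans ?_
  have e1 : √(1 - g') ^ 2 = 1 - g' := Real.sq_sqrt h1
  have e2 : √g' ^ 2 = g' := Real.sq_sqrt hg0
  have e3 : (√g'' * ‖x‖) ^ 2 = g'' * ‖x‖ ^ 2 := by rw [mul_pow, Real.sq_sqrt hg'']
  have e4 : (√(1 - g) * ‖y‖) ^ 2 = (1 - g) * ‖y‖ ^ 2 := by rw [mul_pow, Real.sq_sqrt h2]
  rw [← e3, ← e4]
  generalize √g'' * ‖x‖ = X
  generalize √(1 - g) * ‖y‖ = Y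
  nlinarith [sq_nonneg (√g' * X - √(1 - g') * Y)]

/-- The off-diagonal entries belonging to a `g`-fraction. -/
noncomputable def gEntry (g : ℕ → ℝ) (n : ℕ) : ℝ := √((1 - g n) * g (n + 1))

theorem abs_gEntry_le {g : ℕ → ℝ} (hg : ∀ n, 0 ≤ g n ∧ g n ≤ 1) (n : ℕ) : |gEntry g n| ≤ 1 := by
  rw [gEntry, abs_of_nonneg (Real.sqrt_nonneg _), Real.sqrt_le_iff, one_pow]
  exact ⟨zero_le_one, mul_le_one₀ (by linarith [(hg n).1]) (hg (n + 1)).1 (hg (n + 1)).2⟩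

theorem gEntry_sq {g : ℕ → ℝ} (hg : ∀ n, 0 ≤ g n ∧ g n ≤ 1) (n : ℕ) :
    gEntry g n ^ 2 = (1 - g n) * g (n + 1) :=
  Real.sq_sqrt (mul_nonneg (by linarith [(hg n).2]) (hg (n + 1)).1)

/-- In the sum of the row bounds, `x n` receives weight `g n` from the row above it and `1 - g n`
from the row below. The weights add to 1, except that `g 0` is missing at `n = 0`. -/
theorem norm_jacobiOperator_le {g : ℕ → ℝ} (hg : ∀ n, 0 ≤ g n ∧ g n ≤ 1) :
    ‖jacobiOperator (gEntry g) (abs_gEntry_le hg)‖ ≤ 1 := by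
  refine ContinuousLinearMap.opNorm_le_bound _ zero_le_one fun x => ?_
  rw [one_mul]
  have hx := x.hasSum_norm_sq.summable
  have s1 : Summable fun n => g n * ‖x n‖ ^ 2 :=
    hx.of_nonneg_of_le (fun n => mul_nonneg (hg n).1 (by positivity))
      fun n => mul_le_of_le_one_left (by positivity) (hg n).2
  have s2 : Summable fun n => (1 - g n) * ‖x n‖ ^ 2 := by
    simpa [sub_mul] using hx.sub s1
  have s1' := (summable_nat_add_iff 1).2 s1
  have s1'' := (summable_nat_add_iff 2).2 s1
  have s3 : Summable fun n => Nat.casesOn (motive := fun _ => ℝ) n (g 1 * ‖x 1‖ ^ 2)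
      fun n => g (n + 2) * ‖x (n + 2)‖ ^ 2 + (1 - g n) * ‖x n‖ ^ 2 :=
    (summable_nat_add_iff 1).1 (s1''.add s2)
  refine SeqHilbert.norm_le_of_hasSum_le s3 (fun n => ?_) ?_
  · cases n with
    | zero =>
      rw [jacobiOperator_zero, norm_mul, mul_pow, Complex.norm_real, Real.norm_eq_abs, sq_abs,
        gEntry_sq hg]
      refine mul_le_mul_of_nonneg_right ?_ (by positivity)
      nlinarith [hg 0, hg 1]
    | succ n =>
      rw [jacobiOperator_succ]
      exact norm_sq_sqrt_combination_le (hg n).2 (hg (n + 1)).1 (hg (n + 1)).2 (hg (n + 2)).1 _ _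
  · rw [s3.tsum_eq_zero_add]
    change g 1 * ‖x 1‖ ^ 2 + ∑' n, (g (n + 2) * ‖x (n + 2)‖ ^ 2 + (1 - g n) * ‖x n‖ ^ 2) ≤ _
    rw [s1''.tsum_add s2, ← add_assoc]
    have e1 := s1'.tsum_eq_zero_add
    have e2 := s1.tsum_eq_zero_add
    simp only [zero_add, add_assoc, Nat.reduceAdd] at e1
    rw [← e1]
    have e3 := s1.tsum_add s2
    simp only [sub_mul, one_mul, add_sub_cancel] at e3
    rw [← x.hasSum_norm_sq.tsum_eq, e3]
    simp only [sub_mul, one_mul]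
    have : 0 ≤ g 0 * ‖x 0‖ ^ 2 := mul_nonneg (hg 0).1 (by positivity)
    linarith

/-- A solution of the recurrence of a `g`-fraction yields a solution of the resolvent equation. -/
theorem resolvent_equation {g : ℕ → ℝ} (hg : ∀ n, 0 ≤ g n ∧ g n ≤ 1) {w : ℂ} {φ : ℕ → ℂ}
    (hφ : ∀ n, φ (n + 1) - φ n = (((1 - g n) * g (n + 1) : ℝ) : ℂ) * w ^ 2 * φ (n + 2))
    (x : SeqHilbert)
    (hx : ∀ n, x n = w ^ n * (∏ k ∈ Finset.range n, (gEntry g k : ℂ)) * φ (n + 1)) :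
    x - w • jacobiOperator (gEntry g) (abs_gEntry_le hg) x = φ 0 • lp.single 2 0 (1 : ℂ) := by
  have hsq : ∀ n, (((1 - g n) * g (n + 1) : ℝ) : ℂ) = (gEntry g n : ℂ) ^ 2 := fun n => by
    rw [← gEntry_sq hg, Complex.ofReal_pow]
  simp only [hsq] at hφ
  ext n
  rw [lp.coeFn_sub, Pi.sub_apply, lp.coeFn_smul, Pi.smul_apply, lp.coeFn_smul, Pi.smul_apply,
    smul_eq_mul, smul_eq_mul]
  cases n with
  | zero =>
    rw [jacobiOperator_zero, hx, hx]
    simp only [Finset.prod_range_succ, Finset.prod_range_zero, lp.single_apply_self]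
    linear_combination hφ 0
  | succ n =>
    rw [jacobiOperator_succ, hx, hx, hx, lp.single_apply_ne _ _ _ (Nat.succ_ne_zero n)]
    simp only [Finset.prod_range_succ]
    linear_combination (w ^ (n + 1) * (∏ k ∈ Finset.range n, (gEntry g k : ℂ)) * gEntry g n) *
      hφ (n + 1)

/-- The weights have squared ratio at most `|w|² g (n+1)`, which tends to 0, so `w` need not be
small. -/
theorem summable_chain {g : ℕ → ℝ} (hg : ∀ n, 0 ≤ g n ∧ g n ≤ 1) (hlim : Tendsto g atTop (𝓝 0))
    (w : ℂ) {φ : ℕ → ℂ} {B : ℝ} (hB : ∀ n, ‖φ n‖ ≤ B) :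
    Summable fun n =>
      ‖w ^ n * (∏ k ∈ Finset.range n, (gEntry g k : ℂ)) * φ (n + 1)‖ ^ 2 := by
  have h1 : Summable fun n => ‖w ^ n * (∏ k ∈ Finset.range n, (gEntry g k : ℂ))‖ ^ 2 := by
    refine summable_of_ratio_norm_eventually_le (r := 1 / 2) (by norm_num) ?_
    have h2 : Tendsto (fun n => ‖w‖ ^ 2 * g (n + 1)) atTop (𝓝 0) := by
      simpa using (hlim.comp (tendsto_add_atTop_nat 1)).const_mul (‖w‖ ^ 2)
    filter_upwards [h2.eventually_le_const (show (0 : ℝ) < 1 / 2 by norm_num)] with n hn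
    rw [Finset.prod_range_succ, pow_succ w]
    have h3 : w ^ n * w * ((∏ k ∈ Finset.range n, (gEntry g k : ℂ)) * gEntry g n) =
      w * gEntry g n * (w ^ n * (∏ k ∈ Finset.range n, (gEntry g k : ℂ))) := by ring
    rw [h3, norm_mul (w * gEntry g n : ℂ), mul_pow, norm_mul, norm_pow (‖w * gEntry g n‖)]
    refine mul_le_mul_of_nonneg_right ?_ (norm_nonneg _)
    rw [norm_norm, norm_mul, mul_pow, Complex.norm_real, Real.norm_eq_abs, sq_abs, gEntry_sq hg]
    refine le_trans (mul_le_mul_of_nonneg_left ?_ (by positivity)) hn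
    nlinarith [hg n, hg (n + 1)]
  refine (h1.mul_right (B ^ 2)).of_nonneg_of_le (fun n => by positivity) fun n => ?_
  rw [norm_mul, mul_pow]
  exact mul_le_mul_of_nonneg_left (pow_le_pow_left₀ (norm_nonneg _) (hB _) 2) (by positivity)

theorem one_sub_mul_ne_zero_of_mem_cutPlane {z : ℂ} (hz : z ∈ cutPlane) {t : ℝ} (ht0 : 0 ≤ t)
    (ht1 : t ≤ 1) : (1 - t * z : ℂ) ≠ 0 := by
  intro h
  have h1 : (t : ℂ) * z = 1 := (sub_eq_zero.1 h).symm
  have hre : t * z.re = 1 := by simpa using congrArg Complex.re h1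
  have him : t * z.im = 0 := by simpa using congrArg Complex.im h1
  have ht : 0 < t := ht0.lt_of_ne (by rintro rfl; simp at hre)
  refine hz ⟨?_, (mul_eq_zero.1 him).resolve_left ht.ne'⟩
  by_contra hlt
  nlinarith

/-- A convergent `g`-fraction is the Stieltjes transform of a probability measure on `[0,1]`. -/
theorem exists_measure_of_gFraction {g : ℕ → ℝ} (hg : ∀ n, 0 ≤ g n ∧ g n ≤ 1)
    (hlim : Tendsto g atTop (𝓝 0)) :
    ∃ ν : Measure ℝ, IsProbabilityMeasure ν ∧ ν (Icc 0 1)ᶜ = 0 ∧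
      ∀ z ∈ cutPlane, ∀ φ : ℕ → ℂ, (∃ B, ∀ n, ‖φ n‖ ≤ B) →
        (∀ n, φ (n + 1) - φ n = (((1 - g n) * g (n + 1) : ℝ) : ℂ) * z * φ (n + 2)) →
        φ 1 = φ 0 * ∫ t : ℝ, 1 / (1 - t * z) ∂ν := by
  set J := jacobiOperator (gEntry g) (abs_gEntry_le hg) with hJdef
  have hJ : IsSelfAdjoint J := isSelfAdjoint_jacobiOperator _ _
  have hn : ‖J‖ ≤ 1 := norm_jacobiOperator_le hg
  set e : SeqHilbert := lp.single 2 0 1 with hedef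
  have he : ‖e‖ = 1 := by rw [hedef, lp.norm_single (by norm_num), norm_one]
  obtain ⟨ν, hν, hνs, hνi⟩ := exists_spectralMeasure hJ hn he
  have hsq : Measurable fun l : ℝ => l ^ 2 := by fun_prop
  refine ⟨ν.map fun l => l ^ 2, Measure.isProbabilityMeasure_map hsq.aemeasurable, ?_, ?_⟩
  · rw [Measure.map_apply hsq measurableSet_Icc.compl]
    have hsub : (fun l : ℝ => l ^ 2) ⁻¹' (Icc 0 1)ᶜ ⊆ (Icc (-1) 1)ᶜ := fun l hl hl' =>
      hl ⟨sq_nonneg l, by nlinarith [hl'.1, hl'.2]⟩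
    exact measure_mono_null hsub hνs
  rintro z hz φ ⟨B, hB⟩ hφ
  obtain ⟨w, hw⟩ := IsAlgClosed.exists_pow_nat_eq z two_pos
  have hne : ∀ l ∈ Icc (-1 : ℝ) 1, (1 - ((l ^ 2 : ℝ) : ℂ) * z) ≠ 0 := fun l hl =>
    one_sub_mul_ne_zero_of_mem_cutPlane hz (sq_nonneg l) (by nlinarith [hl.1, hl.2])
  -- Both square roots of `z` are admissible; averaging the two formulas replaces `1/(1 - wl)` by
  -- `1/(1 - l²z)`.
  have key : ∀ v : ℂ, v ^ 2 = z → (∀ l ∈ Icc (-1 : ℝ) 1, (1 - v * l : ℂ) ≠ 0) ∧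
      φ 1 = φ 0 * ∫ l : ℝ, 1 / (1 - v * l) ∂ν := by
    intro v hv
    have hvl : ∀ l ∈ Icc (-1 : ℝ) 1, (1 - v * l : ℂ) ≠ 0 := by
      intro l hl h0
      refine hne l hl ?_
      push_cast
      linear_combination (1 + v * l) * h0 + l ^ 2 * hv
    refine ⟨hvl, ?_⟩
    set x : SeqHilbert := ⟨_, memℓp_two_of_summable (summable_chain hg hlim v hB)⟩ with hxdef
    have hx := resolvent_equation hg (w := v) (φ := φ) (by rwa [hv]) x fun n => rfl
    have h := inner_eq_integral_of_resolvent hJ hn hνs hνi hvl hx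
    rw [← h, hedef, lp.inner_single_left]
    simp [hxdef]
  obtain ⟨h1, e1⟩ := key w hw
  obtain ⟨h2, e2⟩ := key (-w) (by rw [neg_sq, hw])
  have hint : ∀ {v : ℂ}, (∀ l ∈ Icc (-1 : ℝ) 1, (1 - v * l : ℂ) ≠ 0) →
      Integrable (fun l : ℝ => 1 / (1 - v * l)) ν := by
    intro v hv
    exact integrable_of_continuousOn_Icc hνs (continuousOn_const.div (by fun_prop) hv)
  rw [integral_map hsq.aemeasurable (Measurable.aestronglyMeasurable (by fun_prop))]
  have hsum : ∫ l : ℝ, 1 / (1 - ((l ^ 2 : ℝ) : ℂ) * z) ∂ν =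
      ((∫ l : ℝ, 1 / (1 - w * l) ∂ν) + ∫ l : ℝ, 1 / (1 - -w * l) ∂ν) / 2 := by
    rw [← integral_add (hint h1) (hint h2), ← integral_div]
    refine integral_congr_ae ?_
    filter_upwards [show ∀ᵐ l ∂ν, l ∈ Icc (-1 : ℝ) 1 from hνs] with l hl
    have n1 := h1 l hl
    have n2 := h2 l hl
    have n3 : (1 - ((l ^ 2 : ℝ) : ℂ) * z) = (1 - w * l) * (1 - -w * l) := by
      rw [← hw]
      push_cast
      ring
    rw [n3]
    simp only [neg_mul, sub_neg_eq_add] at n2 ⊢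
    field_simp
    ring
  rw [hsum]
  linear_combination e1 / 2 + e2 / 2

/-! ### Probability measures on `[0,1]` as Lebesgue–Stieltjes measures -/

section
variable {ν : Measure ℝ} [IsProbabilityMeasure ν]

theorem cdf_eq_zero_of_neg (hν : ν (Icc 0 1)ᶜ = 0) {x : ℝ} (hx : x < 0) :
    ProbabilityTheory.cdf ν x = 0 := by
  rw [ProbabilityTheory.cdf_eq_real, measureReal_def]
  have hsub : Iic x ⊆ (Icc 0 1)ᶜ := fun y hy hy' => by
    have h1 : y ≤ x := hy
    linarith [hy'.1]
  rw [measure_mono_null hsub hν, ENNReal.toReal_zero]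

theorem cdf_eq_one_of_one_le (hν : ν (Icc 0 1)ᶜ = 0) {x : ℝ} (hx : 1 ≤ x) :
    ProbabilityTheory.cdf ν x = 1 := by
  rw [ProbabilityTheory.cdf_eq_real, ← compl_compl (Iic x), probReal_compl_eq_one_sub
    measurableSet_Iic.compl, measureReal_def]
  have hsub : (Iic x)ᶜ ⊆ (Icc 0 1)ᶜ := fun y hy hy' => hy (hy'.2.trans hx)
  rw [measure_mono_null hsub hν, ENNReal.toReal_zero, sub_zero]

theorem exists_stieltjesMeasure_eq (hν : ν (Icc 0 1)ᶜ = 0) :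
    ∃ μ : unitInterval →o unitInterval, (μ 1 : ℝ) - (μ 0 : ℝ) = 1 ∧ stieltjesMeasure μ = ν := by
  classical
  let μ : unitInterval →o unitInterval :=
    -- The value 0 at `t = 0` turns an atom of `ν` at 0 into a jump of `μ`; the right limit there
    -- restores the distribution function.
    { toFun := fun t => if t = 0 then 0 else
        ⟨ProbabilityTheory.cdf ν t, ProbabilityTheory.cdf_nonneg ν _,
          ProbabilityTheory.cdf_le_one ν _⟩
      monotone' := fun s t hst => by
        by_cases hs : s = 0
        · simp [hs]
        · have ht : t ≠ 0 := fun h => hs (le_antisymm (h ▸ hst) unitInterval.nonneg')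
          simp only [hs, ht, if_false]
          exact ProbabilityTheory.monotone_cdf ν hst }
  have hμ0 : μ 0 = 0 := if_pos rfl
  have hμ : ∀ t : unitInterval, t ≠ 0 → (μ t : ℝ) = ProbabilityTheory.cdf ν t := fun t ht => by
    change ((if t = 0 then 0 else _ : unitInterval) : ℝ) = _
    rw [if_neg ht]
  have hμ1 : (μ 1 : ℝ) = 1 := by
    rw [hμ 1 one_ne_zero]
    exact cdf_eq_one_of_one_le hν le_rfl
  refine ⟨μ, by rw [hμ1, hμ0]; simp, ?_⟩
  rw [← ProbabilityTheory.measure_cdf ν, stieltjesMeasure]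
  congr 1
  ext x
  rw [Monotone.stieltjesFunction_eq]
  refine rightLim_eq_of_tendsto ?_
  have hc : Tendsto (ProbabilityTheory.cdf ν) (𝓝[>] x) (𝓝 (ProbabilityTheory.cdf ν x)) :=
    ((ProbabilityTheory.cdf ν).right_continuous x).mono Ioi_subset_Ici_self
  refine hc.congr' ?_
  rcases lt_or_ge x 0 with hx | hx
  · filter_upwards [Ioo_mem_nhdsGT hx] with y hy
    rw [IccExtend_of_le_left _ _ hy.2.le, cdf_eq_zero_of_neg hν hy.2]
    change (0 : ℝ) = (μ 0 : ℝ)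
    rw [hμ0]
    rfl
  · filter_upwards [self_mem_nhdsWithin] with y hy
    have hy0 : 0 < y := lt_of_le_of_lt hx hy
    rcases le_or_gt y 1 with hy1 | hy1
    · rw [IccExtend_of_mem _ _ ⟨hy0.le, hy1⟩, hμ]
      exact fun h => hy0.ne' (congrArg Subtype.val h)
    · rw [IccExtend_of_right_le _ _ hy1.le, cdf_eq_one_of_one_le hν hy1.le]
      exact hμ1.symm

end

/-! ### Univalence and convexity in the direction of the imaginary axis -/

/-- The horizontal strip `|Im σ| < π/2`. -/
def horizontalStrip : Set ℂ := {σ | |σ.im| < Real.pi / 2}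

theorem ofReal_add_mul_I_mem_strip {x y : ℝ} (hy : |y| < Real.pi / 2) :
    (x + y * Complex.I : ℂ) ∈ horizontalStrip := by
  simpa [horizontalStrip] using hy

/-- If the real part of a continuous function on the strip increases along horizontal lines and has
the same range on each of them, then the image is convex in the direction of the imaginary axis. -/
theorem convexInImDirection_image_strip {F : ℂ → ℂ} (hF : ContinuousOn F horizontalStrip)
    (hmono : ∀ y : ℝ, |y| < Real.pi / 2 → StrictMono fun x : ℝ => (F (x + y * Complex.I)).re)
    (hrange : ∀ σ ∈ horizontalStrip, ∀ y : ℝ, |y| < Real.pi / 2 →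
      (∃ x : ℝ, (F (x + y * Complex.I)).re ≤ (F σ).re) ∧
      ∃ x : ℝ, (F σ).re ≤ (F (x + y * Complex.I)).re) :
    ConvexInImDirection (F '' horizontalStrip) := by
  intro u
  rcases (F '' horizontalStrip ∩ {w : ℂ | w.re = u}).eq_empty_or_nonempty with h0 | hne
  · rw [h0]
    exact convex_empty
  obtain ⟨-, ⟨σ₀, hσ₀, rfl⟩, hu⟩ := hne
  have hcx : ∀ x : ℝ, ContinuousOn (fun y : ℝ => (F (x + y * Complex.I)).re)
      {y | |y| < Real.pi / 2} := fun x =>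
    Complex.continuous_re.comp_continuousOn
      (hF.comp (by fun_prop) fun y hy => ofReal_add_mul_I_mem_strip hy)
  have hex : ∀ y : ℝ, ∃ x : ℝ, |y| < Real.pi / 2 → (F (x + y * Complex.I)).re = u := by
    intro y
    by_cases hy : |y| < Real.pi / 2
    · have hc : Continuous fun x : ℝ => (F (x + y * Complex.I)).re :=
        Complex.continuous_re.comp
          (hF.comp_continuous (by fun_prop) fun x => ofReal_add_mul_I_mem_strip hy)
      have h := hrange σ₀ hσ₀ y hy
      rw [show (F σ₀).re = u from hu] at h
      obtain ⟨x, hx⟩ := mem_range_of_exists_le_of_exists_ge hc h.1 h.2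
      exact ⟨x, fun _ => hx⟩
    · exact ⟨0, fun h => absurd h hy⟩
  -- The level set `Re F = u` is the graph `x = X y` over the interval `|y| < π/2`.
  choose X hX using hex
  -- Strict monotonicity in `x` and continuity in `y` trap the crossing point; no differentiability
  -- is needed.
  have hXc : ContinuousOn X {y | |y| < Real.pi / 2} := by
    intro y₀ hy₀
    refine tendsto_order.2 ⟨fun x hx => ?_, fun x hx => ?_⟩
    · have h := hmono y₀ hy₀ hx
      simp only [hX y₀ hy₀] at h
      filter_upwards [(hcx x y₀ hy₀).eventually_lt_const h, self_mem_nhdsWithin] with y hy hy'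
      rw [← hX y hy'] at hy
      exact (hmono y hy').lt_iff_lt.1 hy
    · have h := hmono y₀ hy₀ hx
      simp only [hX y₀ hy₀] at h
      filter_upwards [(hcx x y₀ hy₀).eventually_const_lt h, self_mem_nhdsWithin] with y hy hy'
      rw [← hX y hy'] at hy
      exact (hmono y hy').lt_iff_lt.1 hy
  set S : Set ℝ := (fun y : ℝ => (F (X y + y * Complex.I)).im) '' {y | |y| < Real.pi / 2}
    with hS
  have hSconv : Convex ℝ S := by
    refine Set.OrdConnected.convex (IsPreconnected.ordConnected ?_)
    refine IsPreconnected.image ?_ _ ?_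
    · have : {y : ℝ | |y| < Real.pi / 2} = Ioo (-(Real.pi / 2)) (Real.pi / 2) := by
        ext y
        rw [mem_ofPred_eq, abs_lt, mem_Ioo]
      rw [this]
      exact isPreconnected_Ioo
    · refine Complex.continuous_im.comp_continuousOn
        (hF.comp ?_ fun y hy => ofReal_add_mul_I_mem_strip hy)
      exact (Complex.continuous_ofReal.comp_continuousOn hXc).add (by fun_prop)
  have himS : ∀ w ∈ F '' horizontalStrip ∩ {w : ℂ | w.re = u}, w.im ∈ S := by
    rintro - ⟨⟨σ, hσ, rfl⟩, hw⟩
    refine ⟨σ.im, hσ, ?_⟩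
    have h1 : X σ.im = σ.re := by
      refine (hmono σ.im hσ).injective ?_
      simp only [hX σ.im hσ, Complex.re_add_im]
      exact hw.symm
    simp only [h1, Complex.re_add_im]
  rintro w₁ hw₁ w₂ hw₂ a b ha hb hab
  have hre : (a • w₁ + b • w₂).re = u := by
    have e1 : w₁.re = u := hw₁.2
    have e2 : w₂.re = u := hw₂.2
    rw [Complex.add_re, Complex.smul_re, Complex.smul_re, e1, e2, smul_eq_mul, smul_eq_mul,
      ← add_mul, hab, one_mul]
  obtain ⟨y, hy, him⟩ := hSconv (himS w₁ hw₁) (himS w₂ hw₂) ha hb hab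
  refine ⟨⟨X y + y * Complex.I, ofReal_add_mul_I_mem_strip hy, Complex.ext ?_ ?_⟩, hre⟩
  · rw [hX y hy, hre]
  · rw [Complex.add_im, Complex.smul_im, Complex.smul_im]
    exact him

/-- The Möbius transformation `W ↦ (W - 1)/(pW + r)`. -/
noncomputable def rayMap (p r : ℝ) (W : ℂ) : ℂ := (W - 1) / (p * W + r)

theorem rayMap_denom_re_pos {p r : ℝ} (hp : 0 ≤ p) (hr : 0 ≤ r) (hpr : 0 < p + r) {W : ℂ}
    (hW : 0 < W.re) : 0 < (p * W + r : ℂ).re := by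
  simp only [Complex.add_re, Complex.re_ofReal_mul, Complex.ofReal_re]
  rcases hp.eq_or_lt with rfl | hp
  · linarith
  · have := mul_pos hp hW
    linarith

theorem ne_zero_of_re_pos {w : ℂ} (h : 0 < w.re) : w ≠ 0 := by
  rintro rfl
  simp at h

theorem re_inv_pos {w : ℂ} (h : 0 < w.re) : 0 < (w⁻¹).re := by
  rw [Complex.inv_re]
  exact div_pos h (Complex.normSq_pos.2 (ne_zero_of_re_pos h))

theorem re_inv_nonneg {w : ℂ} (h : 0 ≤ w.re) : 0 ≤ (w⁻¹).re := by
  rw [Complex.inv_re]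
  exact div_nonneg h (Complex.normSq_nonneg _)

theorem re_exp_pos {σ : ℂ} (h : |σ.im| < Real.pi / 2) : 0 < (Complex.exp σ).re := by
  rw [Complex.exp_re]
  rw [abs_lt] at h
  exact mul_pos (Real.exp_pos _) (Real.cos_pos_of_mem_Ioo ⟨h.1, h.2⟩)

/-- The kernel of the difference quotient of `rayMap p r` in logarithmic coordinates. -/
noncomputable def rayKernel (p r : ℝ) (σ τ : ℂ) : ℂ :=
  (p ^ 2 * Complex.exp ((σ + τ) / 2) +
    p * r * (Complex.exp ((σ - τ) / 2) + Complex.exp (-((σ - τ) / 2))) +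
    r ^ 2 * Complex.exp (-((σ + τ) / 2)))

/-- The points `±(σ ± τ)/2` stay in the strip, where the exponential has positive real part. -/
theorem rayKernel_re_pos {p r : ℝ} (hp : 0 ≤ p) (hr : 0 ≤ r) (hpr : 0 < p + r) {σ τ : ℂ}
    (hσ : σ ∈ horizontalStrip) (hτ : τ ∈ horizontalStrip) : 0 < (rayKernel p r σ τ).re := by
  have h1 := abs_lt.1 (show |σ.im| < Real.pi / 2 from hσ)
  have h2 := abs_lt.1 (show |τ.im| < Real.pi / 2 from hτ)
  have k1 : 0 < (Complex.exp ((σ + τ) / 2)).re :=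
    re_exp_pos (by simp [abs_lt]; constructor <;> linarith)
  have k2 : 0 < (Complex.exp ((σ - τ) / 2)).re :=
    re_exp_pos (by simp [abs_lt]; constructor <;> linarith)
  have k3 : 0 < (Complex.exp (-((σ - τ) / 2))).re :=
    re_exp_pos (by simp [abs_lt]; constructor <;> linarith)
  have k4 : 0 < (Complex.exp (-((σ + τ) / 2))).re :=
    re_exp_pos (by simp [abs_lt]; constructor <;> linarith)
  have e : (rayKernel p r σ τ).re = p ^ 2 * (Complex.exp ((σ + τ) / 2)).re +
      p * r * ((Complex.exp ((σ - τ) / 2)).re + (Complex.exp (-((σ - τ) / 2))).re) +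
      r ^ 2 * (Complex.exp (-((σ + τ) / 2))).re := by
    rw [rayKernel]
    rw [Complex.add_re, Complex.add_re, ← Complex.ofReal_pow, ← Complex.ofReal_pow,
      ← Complex.ofReal_mul, Complex.re_ofReal_mul, Complex.re_ofReal_mul, Complex.re_ofReal_mul,
      Complex.add_re]
  rw [e]
  have l1 : 0 ≤ p * r * ((Complex.exp ((σ - τ) / 2)).re + (Complex.exp (-((σ - τ) / 2))).re) :=
    mul_nonneg (mul_nonneg hp hr) (by linarith)
  rcases hp.eq_or_lt with rfl | hp
  · have : 0 < r ^ 2 * (Complex.exp (-((σ + τ) / 2))).re :=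
      mul_pos (pow_pos (by linarith) 2) k4
    nlinarith
  · have : 0 < p ^ 2 * (Complex.exp ((σ + τ) / 2)).re := mul_pos (pow_pos hp 2) k1
    have : 0 ≤ r ^ 2 * (Complex.exp (-((σ + τ) / 2))).re := mul_nonneg (sq_nonneg r) k4.le
    linarith

/-- For `W = e^σ`, `V = e^τ` the difference is `(p + r)(W - V)/((pW + r)(pV + r))`; dividing
numerator and denominator by `e^((σ+τ)/2)` produces the sinh factor and the kernel. -/
theorem rayMap_sub {p r : ℝ} (hp : 0 ≤ p) (hr : 0 ≤ r) (hpr : 0 < p + r) {σ τ : ℂ}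
    (hσ : σ ∈ horizontalStrip) (hτ : τ ∈ horizontalStrip) :
    rayMap p r (Complex.exp σ) - rayMap p r (Complex.exp τ) =
      (Complex.exp ((σ - τ) / 2) - Complex.exp (-((σ - τ) / 2))) *
        ((p + r : ℝ) * (rayKernel p r σ τ)⁻¹) := by
  have d1 := ne_zero_of_re_pos (rayMap_denom_re_pos hp hr hpr (re_exp_pos hσ))
  have d2 := ne_zero_of_re_pos (rayMap_denom_re_pos hp hr hpr (re_exp_pos hτ))
  set s := Complex.exp (σ / 2) with hs
  set t := Complex.exp (τ / 2) with ht
  have hs0 : s ≠ 0 := Complex.exp_ne_zero _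
  have ht0 : t ≠ 0 := Complex.exp_ne_zero _
  have e1 : Complex.exp σ = s ^ 2 := by rw [hs, ← Complex.exp_nat_mul]; congr 1; push_cast; ring
  have e2 : Complex.exp τ = t ^ 2 := by rw [ht, ← Complex.exp_nat_mul]; congr 1; push_cast; ring
  have e3 : Complex.exp ((σ + τ) / 2) = s * t := by rw [add_div, Complex.exp_add]
  have e4 : Complex.exp ((σ - τ) / 2) = s / t := by rw [sub_div, Complex.exp_sub]
  rw [e1] at d1
  rw [e2] at d2
  have hk : rayKernel p r σ τ = (p * s ^ 2 + r) * (p * t ^ 2 + r) / (s * t) := by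
    rw [rayKernel, Complex.exp_neg, Complex.exp_neg, e3, e4]
    field_simp
    ring
  rw [hk, Complex.exp_neg, e4, rayMap, rayMap, e1, e2]
  push_cast
  generalize hA : (p * s ^ 2 + r : ℂ) = A at *
  generalize hB : (p * t ^ 2 + r : ℂ) = B at *
  field_simp
  rw [← hA, ← hB]
  ring

/-- This symmetry, `σ ↦ -σ` in the strip, transfers estimates at the right end to the left end. -/
theorem rayMap_inv {p r : ℝ} (hp : 0 ≤ p) (hr : 0 ≤ r) (hpr : 0 < p + r) {V : ℂ} (hV : 0 < V.re) :
    rayMap p r V⁻¹ = -rayMap r p V := by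
  have h0 := ne_zero_of_re_pos hV
  have h1 := ne_zero_of_re_pos (rayMap_denom_re_pos hr hp (by linarith) hV)
  have e : (p * V⁻¹ + r : ℂ) = (r * V + p) / V := by
    field_simp
    ring
  rw [rayMap, rayMap, e]
  generalize (r * V + p : ℂ) = D at *
  field_simp
  ring

/-- Far to the right the real part of `rayMap p r` exceeds its value at a given point, uniformly
in `p` and `r`. -/
theorem exists_rayMap_re_le {K : ℝ} (hK : 0 < K) {W₀ : ℂ} (hW₀ : 0 < W₀.re) :
    ∃ R : ℝ, ∀ W : ℂ, R ≤ W.re → ∀ p r : ℝ, 0 ≤ p → 0 ≤ r → p + r = K →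
      (rayMap p r W₀).re ≤ (rayMap p r W).re := by
  set C := 2 * K * ‖W₀‖ + K * ‖W₀‖ ^ 2 with hC
  set m := K * min W₀.re 1 with hm
  have hm0 : 0 < m := mul_pos hK (lt_min hW₀ one_pos)
  -- The 1 keeps `Re (W - W₀)` positive; `C / m` makes the error terms below at most `m`.
  refine ⟨W₀.re + 1 + C / m, fun W hW p r hp hr hpr => ?_⟩
  have hC0 : 0 ≤ C := by positivity
  have hCm : 0 ≤ C / m := by positivity
  have hd : 0 < (W - W₀).re := by
    rw [Complex.sub_re]
    linarith
  have hWre : 0 < W.re := by linarith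
  have n1 := rayMap_denom_re_pos hp hr (hpr ▸ hK) hW₀
  have n2 := rayMap_denom_re_pos hp hr (hpr ▸ hK) hWre
  set D : ℂ := W - W₀ with hD
  have hnorm : C / m ≤ ‖D‖ := by
    refine le_trans ?_ (Complex.re_le_norm D)
    rw [hD, Complex.sub_re]
    linarith
  have hlow : m ≤ (p * W₀ + r : ℂ).re := by
    simp only [Complex.add_re, Complex.re_ofReal_mul, Complex.ofReal_re]
    rw [hm, ← hpr, add_mul]
    have k1 := mul_le_mul_of_nonneg_left (min_le_left W₀.re 1) hp
    have k2 := mul_le_mul_of_nonneg_left (min_le_right W₀.re 1) hr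
    linarith
  -- This number is `K` divided by the difference of the two values. Its terms of unknown sign all
  -- carry a factor `p` and are dominated by `p * m`, so the bound survives `p → 0`.
  have hq : 0 ≤ (p * (p * W₀ + r) + (p * W₀ + r) ^ 2 / D : ℂ).re := by
    have e : (p * (p * W₀ + r) + (p * W₀ + r) ^ 2 / D : ℂ) =
        ((p : ℝ) : ℂ) * (p * W₀ + r) + ((r ^ 2 : ℝ) : ℂ) * D⁻¹ +
          ((p : ℝ) : ℂ) * ((2 * r * W₀ + p * W₀ ^ 2) * D⁻¹) := by
      push_cast
      ring
    rw [e, Complex.add_re, Complex.add_re, Complex.re_ofReal_mul, Complex.re_ofReal_mul,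
      Complex.re_ofReal_mul]
    have k1 : 0 ≤ r ^ 2 * (D⁻¹).re := mul_nonneg (sq_nonneg r) (re_inv_pos hd).le
    have k2 : ‖(2 * r * W₀ + p * W₀ ^ 2 : ℂ) * D⁻¹‖ ≤ m := by
      have hDpos : 0 < ‖D‖ := norm_pos_iff.2 (ne_zero_of_re_pos hd)
      rw [norm_mul, norm_inv, ← div_eq_mul_inv, div_le_iff₀ hDpos]
      have k3 : ‖(2 * r * W₀ + p * W₀ ^ 2 : ℂ)‖ ≤ C := by
        refine (norm_add_le _ _).trans ?_
        rw [norm_mul, norm_mul, norm_mul, norm_pow, Complex.norm_real, Complex.norm_real,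
          Complex.norm_ofNat, Real.norm_of_nonneg hp, Real.norm_of_nonneg hr, hC]
        gcongr <;> linarith
      rw [div_le_iff₀ hm0] at hnorm
      linarith
    have k4 := (abs_le.1 ((Complex.abs_re_le_norm _).trans k2)).1
    have k5 : 0 ≤ p * ((p * W₀ + r : ℂ).re + ((2 * r * W₀ + p * W₀ ^ 2 : ℂ) * D⁻¹).re) :=
      mul_nonneg hp (by linarith)
    linarith
  have hdiff : rayMap p r W - rayMap p r W₀ =
      ((K : ℝ) : ℂ) * (p * (p * W₀ + r) + (p * W₀ + r) ^ 2 / D : ℂ)⁻¹ := by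
    have n1' := ne_zero_of_re_pos n1
    have n2' := ne_zero_of_re_pos n2
    have n3' := ne_zero_of_re_pos hd
    have e : (p * (p * W₀ + r) + (p * W₀ + r) ^ 2 / D : ℂ) =
        (p * W₀ + r) * (p * W + r) / D := by
      have hWD : W = D + W₀ := by rw [hD]; ring
      rw [hWD]
      field_simp
      ring
    rw [e, rayMap, rayMap, ← hpr, inv_div, div_sub_div _ _ n2' n1', mul_div_assoc',
      mul_comm (p * W₀ + r : ℂ), hD]
    congr 1
    push_cast
    ring
  have := mul_nonneg hK.le (re_inv_nonneg hq)
  rw [← Complex.re_ofReal_mul, ← hdiff, Complex.sub_re] at this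
  linarith

/-! ### The Stieltjes transform of a probability measure on `[0,1]` -/

/-- The transform `z ↦ ∫ z/(1 - tz) dν(t)`. -/
noncomputable def cauchyTransform (ν : Measure ℝ) (z : ℂ) : ℂ := ∫ t : ℝ, z / (1 - t * z) ∂ν

theorem isOpen_cutPlane : IsOpen cutPlane := by
  have : cutPlane = ({z : ℂ | 1 ≤ z.re} ∩ {z : ℂ | z.im = 0})ᶜ := rfl
  rw [this]
  exact ((isClosed_le continuous_const Complex.continuous_re).inter
    (isClosed_eq Complex.continuous_im continuous_const)).isOpen_compl

theorem halfPlane_subset_cutPlane : {z : ℂ | z.re < 1} ⊆ cutPlane := fun _ hz h =>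
  absurd h.1 (not_le.2 hz)

theorem ball_subset_halfPlane : Metric.ball (0 : ℂ) 1 ⊆ {z : ℂ | z.re < 1} := fun z hz =>
  (Complex.re_le_norm z).trans_lt (mem_ball_zero_iff.1 hz)

/-- The Möbius transformation which, composed with the exponential, maps the strip `|Im σ| < π/2`
onto the half-plane `Re z < 1` (`κ = 0`) and onto the unit disk (`κ = 1`). -/
noncomputable def stripMap (κ : ℝ) (σ : ℂ) : ℂ := (Complex.exp σ - 1) / (Complex.exp σ + κ)

theorem stripMap_denom_ne_zero {κ : ℝ} (hκ : 0 ≤ κ) {σ : ℂ} (hσ : σ ∈ horizontalStrip) :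
    (Complex.exp σ + κ : ℂ) ≠ 0 := by
  have := rayMap_denom_re_pos zero_le_one hκ (by linarith) (re_exp_pos hσ)
  rw [Complex.ofReal_one, one_mul] at this
  exact ne_zero_of_re_pos this

theorem continuousOn_stripMap {κ : ℝ} (hκ : 0 ≤ κ) : ContinuousOn (stripMap κ) horizontalStrip :=
  ContinuousOn.div (by fun_prop) (by fun_prop) fun _ hσ => stripMap_denom_ne_zero hκ hσ

theorem cauchyTransform_stripMap {ν : Measure ℝ} (hν : ν (Icc 0 1)ᶜ = 0) {κ : ℝ} (hκ : 0 ≤ κ) {σ : ℂ}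
    (hσ : σ ∈ horizontalStrip) :
    cauchyTransform ν (stripMap κ σ) = ∫ t : ℝ, rayMap (1 - t) (t + κ) (Complex.exp σ) ∂ν := by
  refine integral_congr_ae ?_
  filter_upwards [show ∀ᵐ t ∂ν, t ∈ Icc (0 : ℝ) 1 from hν] with t ht
  have h1 := stripMap_denom_ne_zero hκ hσ
  have h2 := ne_zero_of_re_pos (rayMap_denom_re_pos (sub_nonneg.2 ht.2) (add_nonneg ht.1 hκ)
    (by linarith) (re_exp_pos hσ))
  have h3 : 1 - (t : ℂ) * stripMap κ σ = (((1 - t : ℝ) : ℂ) * Complex.exp σ + ((t + κ : ℝ) : ℂ)) /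
      (Complex.exp σ + κ) := by
    rw [stripMap, eq_div_iff h1, sub_mul, mul_assoc, div_mul_cancel₀ _ h1]
    push_cast
    ring
  rw [h3, stripMap, rayMap, div_div_div_cancel_right₀ h1]

theorem re_integral {ν : Measure ℝ} {f : ℝ → ℂ} (hf : Integrable f ν) : (∫ t, f t ∂ν).re = ∫ t, (f t).re ∂ν :=
  (integral_re hf).symm

section
variable {ν : Measure ℝ} [IsProbabilityMeasure ν]

theorem differentiableAt_cauchyTransform (hν : ν (Icc 0 1)ᶜ = 0) {z₀ : ℂ} (hz₀ : z₀ ∈ cutPlane) :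
    DifferentiableAt ℂ (cauchyTransform ν) z₀ := by
  have hae : ∀ᵐ t ∂ν, t ∈ Icc (0 : ℝ) 1 := hν
  obtain ⟨t₀, ht₀, hmin⟩ := isCompact_Icc.exists_isMinOn (nonempty_Icc.2 (zero_le_one' ℝ))
    (f := fun t : ℝ => ‖(1 - t * z₀ : ℂ)‖) (by fun_prop)
  set δ := ‖(1 - t₀ * z₀ : ℂ)‖ with hδ
  have hδ0 : 0 < δ := norm_pos_iff.2 (one_sub_mul_ne_zero_of_mem_cutPlane hz₀ ht₀.1 ht₀.2)
  have hlow : ∀ t ∈ Icc (0 : ℝ) 1, ∀ z ∈ Metric.ball z₀ (δ / 2), δ / 2 ≤ ‖(1 - t * z : ℂ)‖ := by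
    intro t ht z hz
    have h1 : δ ≤ ‖(1 - t * z₀ : ℂ)‖ := hmin ht
    have h2 : (1 - t * z₀ : ℂ) = (1 - t * z) + t * (z - z₀) := by ring
    have h3 : ‖(t : ℂ) * (z - z₀)‖ ≤ δ / 2 := by
      rw [norm_mul, Complex.norm_real, Real.norm_of_nonneg ht.1]
      have h4 : ‖z - z₀‖ < δ / 2 := mem_ball_iff_norm.1 hz
      exact (mul_le_of_le_one_left (norm_nonneg _) ht.2).trans h4.le
    have h5 := norm_add_le (1 - t * z : ℂ) (t * (z - z₀))
    rw [← h2] at h5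
    linarith
  have hmeas : ∀ z : ℂ, AEStronglyMeasurable (fun t : ℝ => z / (1 - t * z)) ν := fun z =>
    (Measurable.aestronglyMeasurable (by fun_prop))
  refine ((hasDerivAt_integral_of_dominated_loc_of_deriv_le (μ := ν) (bound := fun _ => 1 / (δ / 2) ^ 2)
    (F := fun (z : ℂ) (t : ℝ) => z / (1 - t * z)) (F' := fun (z : ℂ) (t : ℝ) => 1 / (1 - t * z) ^ 2)
    (Metric.ball_mem_nhds z₀ (half_pos hδ0)) (Eventually.of_forall hmeas) ?_
    (Measurable.aestronglyMeasurable (by fun_prop)) ?_ (integrable_const _) ?_).2).differentiableAt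
  · refine integrable_of_continuousOn_Icc hν (continuousOn_const.div (by fun_prop) fun t ht => ?_)
    exact one_sub_mul_ne_zero_of_mem_cutPlane hz₀ ht.1 ht.2
  · filter_upwards [hae] with t ht z hz
    rw [norm_div, norm_one, norm_pow]
    exact one_div_le_one_div_of_le (by positivity)
      (pow_le_pow_left₀ (by positivity) (hlow t ht z hz) 2)
  · filter_upwards [hae] with t ht z hz
    have hne : (1 - t * z : ℂ) ≠ 0 :=
      norm_pos_iff.1 ((half_pos hδ0).trans_le (hlow t ht z hz))
    have h1 : HasDerivAt (fun z : ℂ => 1 - (t : ℂ) * z) (-(t : ℂ)) z := by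
      simpa using ((hasDerivAt_id z).const_mul (t : ℂ)).const_sub 1
    have h2 : (1 * (1 - t * z) - z * -(t : ℂ)) / (1 - t * z) ^ 2 = 1 / (1 - t * z) ^ 2 := by ring
    rw [← h2]
    exact (hasDerivAt_id z).div h1 hne

theorem analyticOnNhd_cauchyTransform (hν : ν (Icc 0 1)ᶜ = 0) :
    AnalyticOnNhd ℂ (cauchyTransform ν) cutPlane :=
  DifferentiableOn.analyticOnNhd
    (fun _ hz => (differentiableAt_cauchyTransform hν hz).differentiableWithinAt) isOpen_cutPlane

theorem integrable_rayMap (hν : ν (Icc 0 1)ᶜ = 0) {κ : ℝ} (hκ : 0 ≤ κ) {W : ℂ} (hW : 0 < W.re) :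
    Integrable (fun t : ℝ => rayMap (1 - t) (t + κ) W) ν := by
  refine integrable_of_continuousOn_Icc hν (continuousOn_const.div (by fun_prop) fun t ht => ?_)
  exact ne_zero_of_re_pos (rayMap_denom_re_pos (sub_nonneg.2 ht.2) (add_nonneg ht.1 hκ)
    (by linarith [ht.1, ht.2]) hW)

/-- The difference quotient of the transform in logarithmic coordinates has positive real part. -/
theorem exists_cauchyTransform_sub (hν : ν (Icc 0 1)ᶜ = 0) {κ : ℝ} (hκ : 0 ≤ κ) {σ τ : ℂ}
    (hσ : σ ∈ horizontalStrip) (hτ : τ ∈ horizontalStrip) :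
    ∃ I : ℂ, 0 < I.re ∧ cauchyTransform ν (stripMap κ σ) - cauchyTransform ν (stripMap κ τ) =
      (Complex.exp ((σ - τ) / 2) - Complex.exp (-((σ - τ) / 2))) * I := by
  have hae : ∀ᵐ t ∂ν, t ∈ Icc (0 : ℝ) 1 := hν
  have hpr : ∀ t : ℝ, 1 - t + (t + κ) = 1 + κ := fun t => by ring
  have hpos : ∀ t ∈ Icc (0 : ℝ) 1, 0 < (rayKernel (1 - t) (t + κ) σ τ).re := fun t ht =>
    rayKernel_re_pos (sub_nonneg.2 ht.2) (add_nonneg ht.1 hκ) (by linarith) hσ hτ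
  have hint : Integrable (fun t : ℝ => ((1 + κ : ℝ) : ℂ) * (rayKernel (1 - t) (t + κ) σ τ)⁻¹) ν := by
    refine integrable_of_continuousOn_Icc hν (continuousOn_const.mul (ContinuousOn.inv₀ ?_ ?_))
    · unfold rayKernel
      fun_prop
    · exact fun t ht => ne_zero_of_re_pos (hpos t ht)
  have hpos' : ∀ t ∈ Icc (0 : ℝ) 1,
      0 < (((1 + κ : ℝ) : ℂ) * (rayKernel (1 - t) (t + κ) σ τ)⁻¹).re := fun t ht => by
    rw [Complex.re_ofReal_mul]
    exact mul_pos (by linarith) (re_inv_pos (hpos t ht))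
  refine ⟨∫ t : ℝ, ((1 + κ : ℝ) : ℂ) * (rayKernel (1 - t) (t + κ) σ τ)⁻¹ ∂ν, ?_, ?_⟩
  · rw [re_integral hint, integral_pos_iff_support_of_nonneg_ae _
      (show Integrable (fun t : ℝ => (((1 + κ : ℝ) : ℂ) *
        (rayKernel (1 - t) (t + κ) σ τ)⁻¹).re) ν from hint.re)]
    · have hsub : Icc (0 : ℝ) 1 ⊆ Function.support fun t : ℝ =>
          (((1 + κ : ℝ) : ℂ) * (rayKernel (1 - t) (t + κ) σ τ)⁻¹).re := fun t ht => (hpos' t ht).ne'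
      refine lt_of_lt_of_le ?_ (measure_mono hsub)
      rw [(prob_compl_eq_zero_iff measurableSet_Icc).1 hν]
      exact one_pos
    · filter_upwards [hae] with t ht
      exact (hpos' t ht).le
  · rw [cauchyTransform_stripMap hν hκ hσ, cauchyTransform_stripMap hν hκ hτ,
      ← integral_sub (integrable_rayMap hν hκ (re_exp_pos hσ))
        (integrable_rayMap hν hκ (re_exp_pos hτ)), ← integral_const_mul]
    refine integral_congr_ae ?_
    filter_upwards [hae] with t ht
    rw [rayMap_sub (sub_nonneg.2 ht.2) (add_nonneg ht.1 hκ) (by linarith) hσ hτ, hpr]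

/-- Equal values kill the sinh factor, so `e^σ = e^τ`, and the exponential is injective on the
strip. -/
theorem injOn_cauchyTransform_stripMap (hν : ν (Icc 0 1)ᶜ = 0) {κ : ℝ} (hκ : 0 ≤ κ) :
    InjOn (fun σ => cauchyTransform ν (stripMap κ σ)) horizontalStrip := by
  intro σ hσ τ hτ h
  obtain ⟨I, hI, hsub⟩ := exists_cauchyTransform_sub hν hκ hσ hτ
  rw [show cauchyTransform ν (stripMap κ σ) = cauchyTransform ν (stripMap κ τ) from h, sub_self,
    eq_comm, mul_eq_zero, or_iff_left (ne_zero_of_re_pos hI), sub_eq_zero] at hsub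
  have h1 : Complex.exp σ = Complex.exp τ := by
    have e1 : Complex.exp σ = Complex.exp ((σ - τ) / 2) * Complex.exp ((σ + τ) / 2) := by
      rw [← Complex.exp_add]; congr 1; ring
    have e2 : Complex.exp τ = Complex.exp (-((σ - τ) / 2)) * Complex.exp ((σ + τ) / 2) := by
      rw [← Complex.exp_add]; congr 1; ring
    rw [e1, e2, hsub]
  have hs := abs_lt.1 (show |σ.im| < Real.pi / 2 from hσ)
  have ht := abs_lt.1 (show |τ.im| < Real.pi / 2 from hτ)
  exact Complex.exp_inj_of_neg_pi_lt_of_le_pi (by linarith [Real.pi_pos]) (by linarith [Real.pi_pos])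
    (by linarith [Real.pi_pos]) (by linarith [Real.pi_pos]) h1

/-- On a horizontal line the sinh factor is real and positive for increasing `x`. -/
theorem strictMono_re_cauchyTransform (hν : ν (Icc 0 1)ᶜ = 0) {κ : ℝ} (hκ : 0 ≤ κ) {y : ℝ}
    (hy : |y| < Real.pi / 2) :
    StrictMono fun x : ℝ => (cauchyTransform ν (stripMap κ (x + y * Complex.I))).re := by
  intro x x' hx
  obtain ⟨I, hI, hsub⟩ := exists_cauchyTransform_sub hν hκ
    (ofReal_add_mul_I_mem_strip (x := x') hy) (ofReal_add_mul_I_mem_strip (x := x) hy)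
  have e : (x' + y * Complex.I - (x + y * Complex.I)) / 2 = (((x' - x) / 2 : ℝ) : ℂ) := by
    push_cast
    ring
  rw [e, ← Complex.ofReal_neg, ← Complex.ofReal_exp, ← Complex.ofReal_exp,
    ← Complex.ofReal_sub] at hsub
  have h := congrArg Complex.re hsub
  rw [Complex.sub_re, Complex.re_ofReal_mul] at h
  have hlt : Real.exp (-((x' - x) / 2)) < Real.exp ((x' - x) / 2) :=
    Real.exp_lt_exp.2 (by linarith)
  have := mul_pos (sub_pos.2 hlt) hI
  simp only
  linarith

theorem exists_re_exp_ge {y : ℝ} (hy : |y| < Real.pi / 2) (R : ℝ) :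
    ∃ x : ℝ, R ≤ (Complex.exp (x + y * Complex.I)).re := by
  have hcos : 0 < Real.cos y := Real.cos_pos_of_mem_Ioo (abs_lt.1 hy)
  obtain ⟨x, hx⟩ := (Real.tendsto_exp_atTop.eventually_ge_atTop (R / Real.cos y)).exists
  refine ⟨x, ?_⟩
  rw [div_le_iff₀ hcos] at hx
  simpa [Complex.exp_re] using hx

/-- The kernels have `p + r = 1 + κ` for every `t`, so one `x` compares all integrands at once and
the inequality integrates. -/
theorem re_cauchyTransform_range (hν : ν (Icc 0 1)ᶜ = 0) {κ : ℝ} (hκ : 0 ≤ κ) {σ : ℂ}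
    (hσ : σ ∈ horizontalStrip) {y : ℝ} (hy : |y| < Real.pi / 2) :
    (∃ x : ℝ, (cauchyTransform ν (stripMap κ (x + y * Complex.I))).re ≤
      (cauchyTransform ν (stripMap κ σ)).re) ∧
    ∃ x : ℝ, (cauchyTransform ν (stripMap κ σ)).re ≤
      (cauchyTransform ν (stripMap κ (x + y * Complex.I))).re := by
  have hae : ∀ᵐ t ∂ν, t ∈ Icc (0 : ℝ) 1 := hν
  have hK : 0 < 1 + κ := by linarith
  have hneg : -σ ∈ horizontalStrip := by simpa [horizontalStrip] using hσ
  have mono : ∀ τ ∈ horizontalStrip, ∀ τ' ∈ horizontalStrip,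
      (∀ t ∈ Icc (0 : ℝ) 1, (rayMap (1 - t) (t + κ) (Complex.exp τ)).re ≤
        (rayMap (1 - t) (t + κ) (Complex.exp τ')).re) →
      (cauchyTransform ν (stripMap κ τ)).re ≤ (cauchyTransform ν (stripMap κ τ')).re := by
    intro τ hτ τ' hτ' h
    have i1 := integrable_rayMap hν hκ (re_exp_pos hτ)
    have i2 := integrable_rayMap hν hκ (re_exp_pos hτ')
    rw [cauchyTransform_stripMap hν hκ hτ, cauchyTransform_stripMap hν hκ hτ', re_integral i1,
      re_integral i2]
    refine integral_mono_ae i1.re i2.re ?_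
    filter_upwards [hae] with t ht using h t ht
  constructor
  · obtain ⟨R, hR⟩ := exists_rayMap_re_le hK (re_exp_pos hneg)
    have hy' : |(-y)| < Real.pi / 2 := by rwa [abs_neg]
    obtain ⟨x, hx⟩ := exists_re_exp_ge hy' R
    have hmem := ofReal_add_mul_I_mem_strip (x := -x) hy
    refine ⟨-x, mono _ hmem _ hσ fun t ht => ?_⟩
    have hp := sub_nonneg.2 ht.2
    have hr := add_nonneg ht.1 hκ
    have h := hR _ hx (t + κ) (1 - t) hr hp (by ring)
    have e1 : Complex.exp σ = (Complex.exp (-σ))⁻¹ := by rw [Complex.exp_neg, inv_inv]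
    have e2 : Complex.exp ((-x : ℝ) + y * Complex.I) =
        (Complex.exp (x + (-y : ℝ) * Complex.I))⁻¹ := by
      rw [← Complex.exp_neg]
      congr 1
      push_cast
      ring
    rw [e1, e2, rayMap_inv hp hr (by linarith) (re_exp_pos hneg),
      rayMap_inv hp hr (by linarith) (re_exp_pos (ofReal_add_mul_I_mem_strip hy')),
      Complex.neg_re, Complex.neg_re]
    exact neg_le_neg h
  · obtain ⟨R, hR⟩ := exists_rayMap_re_le hK (re_exp_pos hσ)
    obtain ⟨x, hx⟩ := exists_re_exp_ge hy R
    refine ⟨x, mono _ hσ _ (ofReal_add_mul_I_mem_strip hy) fun t ht => ?_⟩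
    exact hR _ hx _ _ (sub_nonneg.2 ht.2) (add_nonneg ht.1 hκ) (by ring)

theorem mapsUnivalently_cauchyTransform (hν : ν (Icc 0 1)ᶜ = 0) {κ : ℝ} (hκ : 0 ≤ κ) {U : Set ℂ}
    (hU : stripMap κ '' horizontalStrip = U) (hUo : IsOpen U) (hUc : IsConnected U)
    (hUs : U ⊆ cutPlane) : MapsUnivalentlyOntoConvexInIm (cauchyTransform ν) U := by
  have han : AnalyticOnNhd ℂ (cauchyTransform ν) U :=
    (analyticOnNhd_cauchyTransform hν).mono hUs
  have hinj : InjOn (cauchyTransform ν) U := by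
    rw [← hU]
    rintro - ⟨σ, hσ, rfl⟩ - ⟨τ, hτ, rfl⟩ h
    rw [injOn_cauchyTransform_stripMap hν hκ hσ hτ h]
  refine ⟨hinj, ⟨?_, hUc.image _ han.continuousOn⟩, ?_⟩
  -- Open mapping theorem; injectivity at two nearby points excludes the constant case.
  · rcases han.is_constant_or_isOpen hUc.isPreconnected with ⟨w, hw⟩ | h
    · obtain ⟨z, hz⟩ := hUc.nonempty
      obtain ⟨ε, hε, hball⟩ := Metric.isOpen_iff.1 hUo z hz
      have hz' : z + (ε / 2 : ℝ) ∈ U := hball (by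
        rw [mem_ball_iff_norm, add_sub_cancel_left, Complex.norm_real,
          Real.norm_of_nonneg (by positivity)]
        linarith)
      have := hinj hz hz' ((hw z hz).trans (hw _ hz').symm)
      have h0 : ((ε / 2 : ℝ) : ℂ) = 0 := left_eq_add.1 this
      rw [Complex.ofReal_eq_zero] at h0
      linarith
    · exact h U le_rfl hUo
  · have hmaps : MapsTo (stripMap κ) horizontalStrip U := hU ▸ mapsTo_image _ _
    have h := convexInImDirection_image_strip (F := fun σ => cauchyTransform ν (stripMap κ σ))
      (han.continuousOn.comp (continuousOn_stripMap hκ) hmaps)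
      (fun y hy => strictMono_re_cauchyTransform hν hκ hy)
      (fun σ hσ y hy => re_cauchyTransform_range hν hκ hσ hy)
    rwa [← image_image (cauchyTransform ν) (stripMap κ), hU] at h

end

/-! ### The half-plane and the disk as images of the strip -/

theorem exists_mem_strip_exp_eq {W : ℂ} (hW : 0 < W.re) : ∃ σ ∈ horizontalStrip, Complex.exp σ = W :=
  ⟨Complex.log W, by
    change |(Complex.log W).im| < _
    rw [Complex.log_im]
    exact Complex.abs_arg_lt_pi_div_two_iff.2 (Or.inl hW), Complex.exp_log (ne_zero_of_re_pos hW)⟩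

theorem stripMap_zero_image : stripMap 0 '' horizontalStrip = {z : ℂ | z.re < 1} := by
  ext z
  constructor
  · rintro ⟨σ, hσ, rfl⟩
    have h := re_inv_pos (re_exp_pos hσ)
    have e : stripMap 0 σ = 1 - (Complex.exp σ)⁻¹ := by
      rw [stripMap, Complex.ofReal_zero, add_zero, sub_div, div_self (Complex.exp_ne_zero σ),
        one_div]
    rw [mem_ofPred_eq, e, Complex.sub_re, Complex.one_re]
    linarith
  · intro hz
    have h1 : 0 < (1 - z).re := by
      rw [Complex.sub_re, Complex.one_re]
      exact sub_pos.2 hz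
    obtain ⟨σ, hσ, he⟩ := exists_mem_strip_exp_eq (re_inv_pos h1)
    refine ⟨σ, hσ, ?_⟩
    have h0 := ne_zero_of_re_pos h1
    rw [stripMap, he, Complex.ofReal_zero, add_zero, sub_div, div_self (inv_ne_zero h0), one_div,
      inv_inv]
    ring

theorem stripMap_one_image : stripMap 1 '' horizontalStrip = Metric.ball 0 1 := by
  ext z
  constructor
  · rintro ⟨σ, hσ, rfl⟩
    have h := re_exp_pos hσ
    have h0 := stripMap_denom_ne_zero zero_le_one hσ
    rw [mem_ball_zero_iff, stripMap, norm_div, div_lt_one (norm_pos_iff.2 h0)]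
    refine lt_of_pow_lt_pow_left₀ 2 (norm_nonneg _) ?_
    rw [Complex.sq_norm, Complex.sq_norm, Complex.normSq_apply, Complex.normSq_apply]
    simp only [Complex.sub_re, Complex.add_re, Complex.one_re, Complex.sub_im, Complex.add_im,
      Complex.one_im, Complex.ofReal_re, Complex.ofReal_im]
    nlinarith
  · intro hz
    have h1 : 0 < (1 - z).re := by
      rw [Complex.sub_re, Complex.one_re]
      exact sub_pos.2 (ball_subset_halfPlane hz)
    have h0 := ne_zero_of_re_pos h1
    have hz2 : Complex.normSq z < 1 := by
      rw [← Complex.sq_norm]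
      have := mem_ball_zero_iff.1 hz
      nlinarith [norm_nonneg z]
    have h2 : 0 < ((1 + z) / (1 - z)).re := by
      rw [Complex.div_re, ← add_div]
      refine div_pos ?_ (Complex.normSq_pos.2 h0)
      rw [Complex.normSq_apply] at hz2
      simp only [Complex.sub_re, Complex.add_re, Complex.one_re, Complex.sub_im, Complex.add_im,
        Complex.one_im]
      nlinarith
    obtain ⟨σ, hσ, he⟩ := exists_mem_strip_exp_eq h2
    refine ⟨σ, hσ, ?_⟩
    rw [stripMap, he, Complex.ofReal_one, div_sub_one h0, div_add_one h0,
      div_div_div_cancel_right₀ h0]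
    ring

theorem mapsUnivalently_ball {ν : Measure ℝ} [IsProbabilityMeasure ν] (hν : ν (Icc 0 1)ᶜ = 0) :
    MapsUnivalentlyOntoConvexInIm (cauchyTransform ν) (Metric.ball 0 1) :=
  mapsUnivalently_cauchyTransform hν zero_le_one stripMap_one_image Metric.isOpen_ball
    ((convex_ball 0 1).isConnected (Metric.nonempty_ball.2 one_pos))
    (ball_subset_halfPlane.trans halfPlane_subset_cutPlane)

theorem mapsUnivalently_halfPlane {ν : Measure ℝ} [IsProbabilityMeasure ν]
    (hν : ν (Icc 0 1)ᶜ = 0) :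
    MapsUnivalentlyOntoConvexInIm (cauchyTransform ν) {z : ℂ | z.re < 1} :=
  mapsUnivalently_cauchyTransform hν le_rfl stripMap_zero_image
    (isOpen_lt Complex.continuous_re continuous_const)
    ((convex_halfSpace_re_lt 1).isConnected ⟨0, by simp⟩) halfPlane_subset_cutPlane

/-! ### The main theorem -/

theorem theorem2p2 (q a b c : ℝ) (hq0 : 0 < q) (hq1 : q < 1)
    (ha : 0 ≤ a) (hb : 0 ≤ b) (hc : 0 ≤ c)
    (hbc0 : 0 ≤ q * (b - c)) (hbc1 : q * (b - c) ≤ 1 - c * q)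
    (hac0 : 0 < a - c) (hac1 : a - c ≤ 1 - c) :
    ∃ (μ : unitInterval →o unitInterval) (f : ℂ → ℂ),
      (μ 1 : ℝ) - (μ 0 : ℝ) = 1 ∧
      -- `f` is the ratio wherever both series converge
      (∀ z ∈ cutPlane, ‖(q : ℂ) * z‖ < 1 →
        heinePhi a b c q (q * z) ≠ 0 ∧
        f z = z * heinePhi a (b * q) (c * q) q (q * z) / heinePhi a b c q (q * z)) ∧
      -- the integral formula holds in the whole cut plane
      (∀ z ∈ cutPlane, f z = stieltjesIntegral μ (fun t => z / (1 - (t : ℂ) * z))) ∧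
      AnalyticOnNhd ℂ f cutPlane ∧
      MapsUnivalentlyOntoConvexInIm f (Metric.ball 0 1) ∧
      MapsUnivalentlyOntoConvexInIm f {z : ℂ | z.re < 1} := by
  have hac : c < a := by linarith
  have ha1 : a ≤ 1 := by linarith
  have hc1 : c < 1 := hac.trans_le ha1
  have hbc : c ≤ b := by nlinarith
  have hb1 : b * q ≤ 1 := by nlinarith
  have hg := heineG_mem hq0 hq1 ha1 hb1 hc hc1 hac.le hbc
  have hlim : Tendsto (heineG q a b c) atTop (𝓝 0) := by
    refine squeeze_zero (fun n => (hg n).1) (heineG_le hq0 hq1 ha hb hc hc1) ?_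
    simpa using
      ((tendsto_heineParam hq0 hq1 ha hb).comp (tendsto_add_atTop_nat 1)).div_const (1 - c)
  obtain ⟨ν, hνp, hν, hF⟩ := exists_measure_of_gFraction hg hlim
  obtain ⟨μ, hμ, hμν⟩ := exists_stieltjesMeasure_eq hν
  refine ⟨μ, cauchyTransform ν, hμ, fun z hz hqz => ?_, fun z _ => ?_,
    analyticOnNhd_cauchyTransform hν, mapsUnivalently_ball hν, mapsUnivalently_halfPlane hν⟩
  · have h := hF z hz (fun n => heineChain q a b c n (q * z))
      (exists_norm_heineChain_le hq0 hq1 ha ha1 hb hb1 hc hc1 hqz)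
      (heineChain_recurrence hq0 hq1 ha ha1 hb hb1 hc hc1 hqz)
    -- The product form of `h`, valid before any division, supplies the implication from a zero of
    -- the denominator to one of the numerator series.
    have h0 := heineChain_zero_ne_zero hq0 hq1 ha1 hb1 hc hac hbc hqz fun h0 => by
      rw [h, h0, zero_mul]
    have e0 : heineChain q a b c 0 (q * z) = heinePhi a b c q (q * z) := by
      simp [heineChain, heineParam]
    have e1 : heineChain q a b c 1 (q * z) = heinePhi a (b * q) (c * q) q (q * z) := by
      rw [heineChain, heinePhi_comm]
      simp [heineParam]
    rw [e0] at h0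
    refine ⟨h0, ?_⟩
    simp only [e0, e1] at h
    rw [h, eq_div_iff h0, cauchyTransform]
    simp only [div_eq_mul_one_div z]
    rw [integral_const_mul]
    ring
  · rw [stieltjesIntegral, hμν, Measure.restrict_eq_self_of_ae_mem
      (show ∀ᵐ t ∂ν, t ∈ Icc (0 : ℝ) 1 from hν)]
    rfl
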